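/- Let $n\ge 1$, $I=\{1,\dots,n\}$, and let $S$ be the set of non-empty subsets of $I$. Fix weights $a_s\ge 0$ $(s\in S)$ and, for every $N\ge n$, integers $k(i,N)\ge 1$ with $\sum_{i=1}^n k(i,N)=N$ and $k(i,N)/N\to p_i>0$ as $N\to\infty$. A configuration is $\sigma=(\sigma_1,\dots,\sigma_n)$ with $\sigma_i\in\{-1,1\}^{k(i,N)}$; for $s\in S$ write $\sigma(s)=(\sigma_i)_{i\in s}$. *Gaussian Bolthausen–Kistler GREM.* For each $N\ge n$ let $\xi(s,\sigma(s))$ ($s\in S$, $\sigma(s)\in\prod_{i\in s}\{-1,1\}^{k(i,N)}$) be independent $\mathcal N(0,1/N)$ variables (no assumption is made on the joint law for different $N$; all variables are defined on one probability space). Put $H_N(\sigma)=N\sum_{s\in S}a_s\,\xi(s,\sigma(s))$ and $Z_N(\beta)=\sum_\sigma e^{-\beta H_N(\sigma)}$, $\beta>0$. *Tree GREM of a permutation.* For a permutation $\pi$ of $I$ and $1\le i\le n$ let $w(\pi,i)\ge 0$ be given by $$w^2(\pi,i)=\sum_{\substack{s\subseteq\{\pi(1),\dots,\pi(i)\}\\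 s\not\subseteq\{\pi(1),\dots,\pi(i-1)\}}}a_s^2 .$$ Consider the $n$-level tree in which every node of level $i-1$ has $2^{k(\pi(i),N)}$ children, with independent $\mathcal N(0,N)$ variables $\xi^\pi(\sigma_1\cdots\sigma_i)$ at its nodes of levels $1,\dots,n$, and put $H^\pi_N(\sigma)=\sum_{i=1}^n w(\pi,i)\,\xi^\pi(\sigma_1\cdots\sigma_i)$ and $Z_N^\pi(\beta)=\sum_\sigma e^{-\beta H_N^\pi(\sigma)}$. *The class $\mathcal P_K$.* Let $w_A^2=\sum_{\varnothing\ne s\subseteq A}a_s^2$ for $A\subseteq I$, and for a permutation $\pi$ and $0\le i<j\le n$ let $$B^\pi_{ij}=\sqrt{\frac{2(p_{\pi(i+1)}+\dots+p_{\pi(j)})\log 2}{w^2_{\{\pi(1),\dots,\pi(j)\}}-w^2_{\{\pi(1),\dots,\pi(i)\}}}}\in(0,\infty],$$ with value $\infty$ if the denominator is $0$. Let $\beta_0=0$, $G_0=\varnothing$ and let $\mathcal P_0$ be the set of all permutations of $I$. As long as $G_{i-1}\ne I$, put $l_{i-1}=|G_{i-1}|$, let $\beta_i=\min\{B^\pi_{l_{i-1}j}:\pi\in\mathcal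 P_{i-1},\ l_{i-1}<j\le n\}$, let $G_i$ be the union of all sets $\{\pi(1),\dots,\pi(j)\}$ for which $(\pi,j)$ attains this minimum, and let $\mathcal P_i=\{\pi\in\mathcal P_{i-1}:\{\pi(1),\dots,\pi(|G_i|)\}=G_i\}$. Let $K$ be the first index with $G_K=I$. **Theorem.** There are deterministic functions $\mathcal E(\beta)$ and $\mathcal E(\pi,\beta)$, $\beta>0$, such that almost surely $\frac1N\log Z_N(\beta)\to\mathcal E(\beta)$ for all $\beta>0$ and, for every $\pi$, almost surely $\frac1N\log Z^\pi_N(\beta)\to\mathcal E(\pi,\beta)$ for all $\beta>0$, and $$\mathcal E(\beta)=\min_{\pi}\mathcal E(\pi,\beta)\qquad\text{for every }\beta>0,$$ the minimum being over all $n!$ permutations $\pi$ of $I$. Moreover, the permutations $\pi$ with $\mathcal E(\pi,\cdot)=\mathcal E(\cdot)$ on $(0,\infty)$ are exactly those in $\mathcal P_K$; and for each fixed $\beta>\beta_{K-1}$ the minimum is attained exactly at the $\pi\in\mathcal P_K$. -/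

import Mathlib

open MeasureTheory ProbabilityTheory Filter Topology
open scoped NNReal ENNReal

noncomputable section

namespace BKGREM

/-! ### Configurations, the Gaussian random fields, and the two models -/

/-- The non-empty subsets of `I = {1, …, n}` (here `I` is `Fin n`). -/
abbrev Subs (n : ℕ) : Type := {s : Finset (Fin n) // s.Nonempty}

/-- A block of `m` two-valued spins; it has `2 ^ m` elements. -/
abbrev Block (m : ℕ) : Type := Fin m → Bool

/-- Configurations `σ = (σ_1, …, σ_n)`, where `σ_i` is a block of `ℓ i` spins. -/
abbrev Config {n : ℕ} (ℓ : Fin n → ℕ) : Type := (i : Fin n) → Block (ℓ i)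

/-- The sites `(s, σ(s))` that carry the random variables of the Bolthausen-Kistler model:
a non-empty set `s` of indices and a partial configuration on `s`. -/
abbrev Site {n : ℕ} (ℓ : Fin n → ℕ) : Type :=
  Σ s : Subs n, ((i : {i : Fin n // i ∈ s.1}) → Block (ℓ i.1))

/-- The nodes `σ_1 ⋯ σ_i`, `1 ≤ i ≤ n`, of the `n`-level tree in which every node of level
`i - 1` has `2 ^ (ℓ i)` children. -/
abbrev Node {n : ℕ} (ℓ : Fin n → ℕ) : Type :=
  Σ i : Fin n, ((j : {j : Fin n // j ≤ i}) → Block (ℓ j.1))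

/-- The site `(s, σ(s))`, with `σ(s)` the projection of `σ` to the coordinates in `s`. -/
def proj {n : ℕ} {ℓ : Fin n → ℕ} (σ : Config ℓ) (s : Subs n) : Site ℓ :=
  ⟨s, fun i => σ i.1⟩

/-- The node `σ_1 ⋯ σ_i` on the branch `σ`. -/
def ancestor {n : ℕ} {ℓ : Fin n → ℕ} (σ : Config ℓ) (i : Fin n) : Node ℓ :=
  ⟨i, fun j => σ j.1⟩

/-- For every particle number `N ≥ n` the family `ξ N` consists of independent centred
Gaussian variables with variance `v N`. Nothing is said about the joint law for different
values of `N`. -/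
structure IsGaussianField {Ω : Type*} [MeasurableSpace Ω] (P : Measure Ω) (n : ℕ)
    {ι : ℕ → Type*} (v : ℕ → ℝ≥0) (ξ : (N : ℕ) → ι N → Ω → ℝ) : Prop where
  measurable : ∀ N, n ≤ N → ∀ e, Measurable (ξ N e)
  law : ∀ N, n ≤ N → ∀ e, P.map (ξ N e) = gaussianReal 0 (v N)
  indep : ∀ N, n ≤ N → iIndepFun (ξ N) P

/-- The driving variables of the Gaussian BK-GREM: `ξ(s, σ(s))` is `N(0, 1/N)`. -/
def IsBKField {Ω : Type*} [MeasurableSpace Ω] (P : Measure Ω) {n : ℕ} (k : ℕ → Fin n → ℕ)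
    (ξ : (N : ℕ) → Site (k N) → Ω → ℝ) : Prop :=
  IsGaussianField P n (fun N => (N : ℝ≥0)⁻¹) ξ

/-- The driving variables of the Gaussian tree GREM: `ξ(σ_1 ⋯ σ_i)` is `N(0, N)`. -/
def IsTreeField {Ω : Type*} [MeasurableSpace Ω] (P : Measure Ω) {n : ℕ} (k : ℕ → Fin n → ℕ)
    (ξ : (N : ℕ) → Node (k N) → Ω → ℝ) : Prop :=
  IsGaussianField P n (fun N => (N : ℝ≥0)) ξ

/-- The BK Hamiltonian `H_N(σ) = N ∑_s a_s ξ(s, σ(s))`, given the values `x` of the field. -/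
def bkHamiltonian {n : ℕ} (a : Subs n → ℝ) (N : ℕ) {ℓ : Fin n → ℕ} (x : Site ℓ → ℝ)
    (σ : Config ℓ) : ℝ :=
  N * ∑ s : Subs n, a s * x (proj σ s)

/-- The tree GREM Hamiltonian `H_N(σ) = ∑_i b_i ξ(σ_1 ⋯ σ_i)`, given the values `x` of the
field. -/
def treeHamiltonian {n : ℕ} (b : Fin n → ℝ) {ℓ : Fin n → ℕ} (x : Node ℓ → ℝ)
    (σ : Config ℓ) : ℝ :=
  ∑ i : Fin n, b i * x (ancestor σ i)

/-- The partition function `∑_σ exp (-β H(σ))`. As there are `2 ^ N` configurations, it is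
`2 ^ N` times the average of `exp (-β H)` over them. -/
def partitionFunction {n : ℕ} {ℓ : Fin n → ℕ} (H : Config ℓ → ℝ) (β : ℝ) : ℝ :=
  ∑ σ : Config ℓ, Real.exp (-β * H σ)

/-- The free energy `(1 / N) log Z_N(β)` of the `N`-particle system. -/
def freeEnergy {n : ℕ} (N : ℕ) {ℓ : Fin n → ℕ} (H : Config ℓ → ℝ) (β : ℝ) : ℝ :=
  1 / N * Real.log (partitionFunction H β)

/-! ### The tree GREM attached to a permutation -/

/-- `{π(1), …, π(j)}`. -/
def initial {n : ℕ} (π : Equiv.Perm (Fin n)) (j : ℕ) : Finset (Fin n) :=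
  (Finset.univ.filter fun i : Fin n => (i : ℕ) < j).image π

/-- The weight `w(π, i)` (with `i` counted from `0`): its square is the sum of `a_s²` over the
`s ⊆ {π(1), …, π(i)}` that are not contained in `{π(1), …, π(i-1)}`. -/
def levelWeight {n : ℕ} (a : Subs n → ℝ) (π : Equiv.Perm (Fin n)) (i : Fin n) : ℝ :=
  √(∑ s ∈ Finset.univ.filter fun s : Subs n =>
      s.1 ⊆ initial π ((i : ℕ) + 1) ∧ ¬ s.1 ⊆ initial π i, a s ^ 2)

/-! ### The class of permutations -/

/-- `w²_A = ∑_{∅ ≠ s ⊆ A} a_s²`. -/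
def wSq {n : ℕ} (a : Subs n → ℝ) (A : Finset (Fin n)) : ℝ :=
  ∑ s ∈ Finset.univ.filter fun s : Subs n => s.1 ⊆ A, a s ^ 2

/-- `B^π_{ij}` for `0 ≤ i < j ≤ n`; it is `∞` if the denominator vanishes. -/
def ratio {n : ℕ} (p : Fin n → ℝ) (a : Subs n → ℝ) (π : Equiv.Perm (Fin n)) (i j : ℕ) : ℝ≥0∞ :=
  (ENNReal.ofReal
      (2 * (∑ m ∈ Finset.univ.filter fun m : Fin n => i ≤ m.val ∧ m.val < j, p (π m)) * Real.log 2) /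
    ENNReal.ofReal (wSq a (initial π j) - wSq a (initial π i))) ^ (1 / 2 : ℝ)

/-- The minimum of `B^π_{lj}` over `π` in the class `Q` and `l < j ≤ n`
(it is `∞` if there is no such `j`). -/
def minRatio {n : ℕ} (p : Fin n → ℝ) (a : Subs n → ℝ) (Q : Finset (Equiv.Perm (Fin n)))
    (l : ℕ) : ℝ≥0∞ :=
  ⨅ π ∈ Q, ⨅ j ∈ Finset.Ioc l n, ratio p a π l j

open Classical in
/-- The union of `G` and of all the sets `{π(1), …, π(j)}` such that `(π, j)` attains the
minimum `minRatio` for `l = |G|`. -/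
def nextSet {n : ℕ} (p : Fin n → ℝ) (a : Subs n → ℝ) (G : Finset (Fin n))
    (Q : Finset (Equiv.Perm (Fin n))) : Finset (Fin n) :=
  G ∪ ((Q ×ˢ Finset.Ioc G.card n).filter fun x =>
    ratio p a x.1 G.card x.2 = minRatio p a Q G.card).biUnion fun x => initial x.1 x.2

/-- The pair `(G_i, 𝒫_i)`: `G_0 = ∅`, `𝒫_0` is the set of all permutations, `G_{i+1}` is the
maximal set at which the minimum over `𝒫_i` is attained, and `𝒫_{i+1}` consists of those
`π ∈ 𝒫_i` for which `{π(1), …, π(|G_{i+1}|)} = G_{i+1}`. -/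
def stage {n : ℕ} (p : Fin n → ℝ) (a : Subs n → ℝ) :
    ℕ → Finset (Fin n) × Finset (Equiv.Perm (Fin n))
  | 0 => (∅, Finset.univ)
  | i + 1 =>
    let G := nextSet p a (stage p a i).1 (stage p a i).2
    (G, (stage p a i).2.filter fun π => initial π G.card = G)

/-- `β_0 = 0`, and `β_{i+1}` is the minimum of `B^π_{lj}` over `π ∈ 𝒫_i` and `l < j ≤ n`, where
`l = |G_i|`. -/
def critical {n : ℕ} (p : Fin n → ℝ) (a : Subs n → ℝ) : ℕ → ℝ≥0∞
  | 0 => 0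
  | i + 1 => minRatio p a (stage p a i).2 (stage p a i).1.card

lemma card_initial {n : ℕ} (π : Equiv.Perm (Fin n)) {j : ℕ} (hj : j ≤ n) :
    (initial π j).card = j := by
  rw [initial, Finset.card_image_of_injective _ π.injective, Fin.card_filter_val_lt]
  omega

lemma initial_congr {n : ℕ} {π τ : Equiv.Perm (Fin n)} {l j : ℕ} (hj : j ≤ l)
    (h : ∀ i : Fin n, (i : ℕ) < l → τ i = π i) : initial τ j = initial π j := by
  apply Finset.image_congr
  intro i hi
  simp only [Finset.coe_filter, Finset.mem_univ, true_and, Set.mem_ofPred_eq] at hi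
  exact h i (by omega)

lemma exists_perm_extend {n : ℕ} (π : Equiv.Perm (Fin n)) {G G' : Finset (Fin n)}
    (hG : initial π G.card = G) (hGG' : G ⊆ G') :
    ∃ τ : Equiv.Perm (Fin n), (∀ i : Fin n, (i : ℕ) < G.card → τ i = π i) ∧
      initial τ G'.card = G' := by
  have hn : G'.card ≤ n := by simpa using Finset.card_le_univ G'
  have hc : G.card ≤ G'.card := Finset.card_le_card hGG'
  have h1 : Fintype.card {i : Fin n // (i : ℕ) < G'.card} = G'.card := by
    rw [Fintype.card_subtype, Fin.card_filter_val_lt]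
    omega
  obtain ⟨g, hg⟩ := Finset.exists_equiv_extend_of_card_eq h1
    (s := Finset.univ.filter fun i : {i : Fin n // (i : ℕ) < G'.card} => (i.1 : ℕ) < G.card)
    (f := fun i => π i.1) (by
      intro x hx
      simp only [Finset.mem_image, Finset.mem_filter, Finset.mem_univ, true_and] at hx
      obtain ⟨i, hi, rfl⟩ := hx
      apply hGG'
      rw [← hG]
      exact Finset.mem_image_of_mem _ (by simpa using hi)) (by
      intro x _ y _ hxy
      exact Subtype.ext (π.injective hxy))
  let τ : Equiv.Perm (Fin n) := Equiv.extendSubtype (q := fun x => x ∈ G') g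
  have hτ : ∀ (i : Fin n) (hi : (i : ℕ) < G'.card), τ i = g ⟨i, hi⟩ := fun i hi =>
    Equiv.extendSubtype_apply_of_mem (q := fun x => x ∈ G') g i hi
  refine ⟨τ, fun i hi => ?_, ?_⟩
  · rw [hτ i (by omega), hg _ (by simpa using hi)]
  · apply Finset.eq_of_subset_of_card_le
    · intro x hx
      simp only [initial, Finset.mem_image, Finset.mem_filter, Finset.mem_univ, true_and] at hx
      obtain ⟨i, hi, rfl⟩ := hx
      rw [hτ i hi]
      exact (g _).2
    · rw [card_initial τ hn]

lemma subset_nextSet {n : ℕ} (p : Fin n → ℝ) (a : Subs n → ℝ) (G : Finset (Fin n))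
    (Q : Finset (Equiv.Perm (Fin n))) : G ⊆ nextSet p a G Q :=
  Finset.subset_union_left

lemma stage_spec {n : ℕ} (p : Fin n → ℝ) (a : Subs n → ℝ) (i : ℕ) :
    (stage p a i).2.Nonempty ∧
    (∀ π ∈ (stage p a i).2, initial π (stage p a i).1.card = (stage p a i).1) ∧
    (∀ π ∈ (stage p a i).2, ∀ τ : Equiv.Perm (Fin n),
      (∀ m : Fin n, (m : ℕ) < (stage p a i).1.card → τ m = π m) → τ ∈ (stage p a i).2) := by
  induction i with
  | zero => simp [stage, initial]
  | succ i ih =>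
    obtain ⟨⟨π, hπ⟩, h2, h3⟩ := ih
    have hsub := subset_nextSet p a (stage p a i).1 (stage p a i).2
    have hc := Finset.card_le_card hsub
    simp only [stage, Finset.mem_filter]
    refine ⟨?_, fun π h => h.2, ?_⟩
    · obtain ⟨τ, hτ, hτ'⟩ := exists_perm_extend π (h2 π hπ) hsub
      exact ⟨τ, Finset.mem_filter.2 ⟨h3 π hπ τ hτ, hτ'⟩⟩
    · intro π hπ τ hτ
      refine ⟨h3 π hπ.1 τ fun m hm => hτ m (by omega), ?_⟩
      rw [initial_congr le_rfl hτ]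
      exact hπ.2

lemma card_lt_card_nextSet {n : ℕ} (p : Fin n → ℝ) (a : Subs n → ℝ) {G : Finset (Fin n)}
    {Q : Finset (Equiv.Perm (Fin n))} (hQ : Q.Nonempty) (hG : G.card < n) :
    G.card < (nextSet p a G Q).card := by
  classical
  obtain ⟨π, hπ⟩ := hQ
  have hne : (Q ×ˢ Finset.Ioc G.card n).Nonempty :=
    ⟨(π, n), Finset.mem_product.2 ⟨hπ, Finset.mem_Ioc.2 ⟨hG, le_rfl⟩⟩⟩
  obtain ⟨x, hx, hmin⟩ :=
    Finset.exists_min_image _ (fun x => ratio p a x.1 G.card x.2) hne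
  have hx' := Finset.mem_product.1 hx
  have heq : ratio p a x.1 G.card x.2 = minRatio p a Q G.card := by
    apply le_antisymm
    · refine le_iInf₂ fun τ hτ => le_iInf₂ fun j hj => ?_
      exact hmin (τ, j) (Finset.mem_product.2 ⟨hτ, hj⟩)
    · exact (iInf₂_le x.1 hx'.1).trans (iInf₂_le x.2 hx'.2)
  have hj := Finset.mem_Ioc.1 hx'.2
  have hsub : initial x.1 x.2 ⊆ nextSet p a G Q := by
    refine subset_trans ?_ Finset.subset_union_right
    exact Finset.subset_biUnion_of_mem (fun x : Equiv.Perm (Fin n) × ℕ => initial x.1 x.2)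
      (Finset.mem_filter.2 ⟨hx, heq⟩)
  have := Finset.card_le_card hsub
  rw [card_initial x.1 hj.2] at this
  omega

lemma exists_stage_eq_univ {n : ℕ} (p : Fin n → ℝ) (a : Subs n → ℝ) :
    ∃ i, (stage p a i).1 = Finset.univ := by
  have key : ∀ i, min i n ≤ (stage p a i).1.card := by
    intro i
    induction i with
    | zero => simp
    | succ i ih =>
      have hle := Finset.card_le_card (subset_nextSet p a (stage p a i).1 (stage p a i).2)
      show min (i + 1) n ≤ (nextSet p a (stage p a i).1 (stage p a i).2).card
      by_cases h : (stage p a i).1.card < n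
      · have := card_lt_card_nextSet p a (stage_spec p a i).1 h
        omega
      · omega
  refine ⟨n, Finset.eq_univ_of_card _ ?_⟩
  have h1 := key n
  have h2 := Finset.card_le_univ (stage p a n).1
  simp only [Fintype.card_fin] at h2 ⊢
  omega

/-- The integer `K`: the first `i` with `G_i = I`. -/
def numStages {n : ℕ} (p : Fin n → ℝ) (a : Subs n → ℝ) : ℕ :=
  Nat.find (exists_stage_eq_univ p a)

/-- The class `𝒫_K`: the permutations that map `{1, …, |G_i|}` onto `G_i` for all `i ≤ K`. -/
def finalClass {n : ℕ} (p : Fin n → ℝ) (a : Subs n → ℝ) : Finset (Equiv.Perm (Fin n)) :=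
  (stage p a (numStages p a)).2

end BKGREM

end

open MeasureTheory ProbabilityTheory Filter Topology
open scoped NNReal ENNReal

namespace BKGREM

/-! ### One-dimensional Gaussian estimates -/

/-! After normalisation both models have energies `∑ j, c j * X_j(σ)`, where `X_j(σ)` is a standard
Gaussian depending only on the blocks of `σ` in a set `supp j`: the set `s` itself for the
Bolthausen–Kistler model, `Finset.Iic i` for a tree. One theorem, `ae_tendsto_logPartition`, gives
both free energies as `log 2` plus the supremum of `∑ j, (β c_j x_j - x_j² / 2)` over `x ≥ 0` with
`∑_{supp j ⊆ A} x_j² / 2 ≤ p(A) log 2` for every `A`. These constraints are necessary because only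
`2 ^ k(A)` partial configurations on `A` exist (first moment), and strict constraints suffice by a
second moment argument.

The rest compares finite-dimensional variational problems. The tree of `π` keeps only the
constraints for `A = {π(1), …, π(j)}`, and merging the energies of one level into their Euclidean
norm does not lower the objective, by Cauchy–Schwarz. Hence the free energy of the
Bolthausen–Kistler model is at most that of every tree (`maxGain_le_tree`).

For equality, set `θ_i = min β β_{i+1}` and `x_s = θ_i a_s` when `s` first fits into `G_{i+1}`.
Since `w²` is supermodular and the entropy is additive, unions of minimisers are minimisers, the
`β_i` increase strictly, and `x` obeys all constraints (`feasible_optEnergy`). Weak duality, with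
multipliers that are differences of the `β / θ_i`, makes `x` optimal in every tree compatible with
the chain (`tree_gain_le`).

If `π` violates the chain, then for `β > β_{K-1}` some constraint that held `x` at its value is
absent from the tree, and an exchange of energy between two sets increases the objective
(`exists_chainFeasible_gain_lt`). -/

/-- Exponential moment of half the square of a standard Gaussian variable. -/
noncomputable def expSqMoment (t : ℝ) : ℝ≥0∞ :=
  ∫⁻ x, ENNReal.ofReal (Real.exp (t * x ^ 2 / 2)) ∂gaussianReal 0 1

lemma expSqMoment_lt_top {t : ℝ} (ht : t < 1) : expSqMoment t < ∞ := by
  have hint : Integrable (fun x : ℝ => Real.exp (-((1 - t) / 2) * x ^ 2)) :=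
    integrable_exp_neg_mul_sq (by linarith)
  rw [expSqMoment, gaussianReal_of_var_ne_zero _ one_ne_zero,
    lintegral_withDensity_eq_lintegral_mul _ (measurable_gaussianPDF 0 1) (by fun_prop)]
  refine lt_of_le_of_lt (lintegral_mono (g := fun x : ℝ =>
    ENNReal.ofReal ((√(2 * Real.pi))⁻¹ * Real.exp (-((1 - t) / 2) * x ^ 2))) ?_)
    (hint.const_mul _).lintegral_lt_top
  intro x
  simp only [Pi.mul_apply, gaussianPDF, gaussianPDFReal]
  rw [← ENNReal.ofReal_mul (by positivity), mul_assoc, ← Real.exp_add]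
  apply le_of_eq
  congr 1
  simp only [NNReal.coe_one, mul_one, sub_zero]
  congr 2
  ring

/-- The upper tail of a standard Gaussian variable. -/
noncomputable def gaussianTail (y : ℝ) : ℝ := (gaussianReal 0 1).real (Set.Ici y)

/-- On `[y, y + 1]` the density is at least its value at the right end. The shift by `1` is harmless
on the exponential scale, since `y` will be of the form `√N x`. -/
lemma le_gaussianTail {y : ℝ} (hy : 0 ≤ y) :
    (√(2 * Real.pi))⁻¹ * Real.exp (-(y + 1) ^ 2 / 2) ≤ gaussianTail y := by
  have h1 : gaussianTail y = ∫ x in Set.Ici y, gaussianPDFReal 0 1 x := by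
    rw [gaussianTail, measureReal_def, gaussianReal_apply_eq_integral _ one_ne_zero,
      ENNReal.toReal_ofReal]
    exact integral_nonneg fun x => gaussianPDFReal_nonneg _ _ _
  have h2 : ∫ x in Set.Icc y (y + 1), gaussianPDFReal 0 1 x ≤
      ∫ x in Set.Ici y, gaussianPDFReal 0 1 x :=
    setIntegral_mono_set (integrable_gaussianPDFReal 0 1).integrableOn
      (ae_of_all _ fun x => gaussianPDFReal_nonneg _ _ _)
      (Set.Icc_subset_Ici_self).eventuallyLE
  have h3 : ∫ _ in Set.Icc y (y + 1), (√(2 * Real.pi))⁻¹ * Real.exp (-(y + 1) ^ 2 / 2) ≤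
      ∫ x in Set.Icc y (y + 1), gaussianPDFReal 0 1 x := by
    refine setIntegral_mono_on (integrableOn_const (by simp))
      (integrable_gaussianPDFReal 0 1).integrableOn measurableSet_Icc fun x hx => ?_
    simp only [gaussianPDFReal, NNReal.coe_one, mul_one, sub_zero]
    have : x ^ 2 ≤ (y + 1) ^ 2 := pow_le_pow_left₀ (hy.trans hx.1) hx.2 2
    gcongr
  rw [setIntegral_const] at h3
  simp only [measureReal_def, Real.volume_Icc, add_sub_cancel_left, ENNReal.ofReal_one,
    ENNReal.toReal_one, one_smul] at h3
  linarith

lemma gaussianTail_pos {y : ℝ} (hy : 0 ≤ y) : 0 < gaussianTail y :=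
  lt_of_lt_of_le (by positivity) (le_gaussianTail hy)

/-! ### Gaussian fields indexed by projections of configurations -/

section FiniteVolume

variable {n : ℕ} {ℓ : Fin n → ℕ} {J ι : Type*} {supp : J → Finset (Fin n)}
  {site : Config ℓ → J → ι} {Ω : Type*} [MeasurableSpace Ω] {P : Measure Ω} {X : ι → Ω → ℝ}

/-- The site `site σ j` is determined by `j` and the blocks of `σ` indexed by `supp j`. -/
def IsSiteMap (supp : J → Finset (Fin n)) (site : Config ℓ → J → ι) : Prop :=
  ∀ σ τ i j, site σ i = site τ j ↔ i = j ∧ ∀ m ∈ supp i, σ m = τ m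

/-- A family of independent standard Gaussian variables. -/
structure IsStdGaussian (P : Measure Ω) (X : ι → Ω → ℝ) : Prop where
  measurable : ∀ e, Measurable (X e)
  law : ∀ e, P.map (X e) = gaussianReal 0 1
  indep : iIndepFun X P

lemma IsSiteMap.injective (hs : IsSiteMap supp site) (σ : Config ℓ) :
    Function.Injective (site σ) := fun i j h => ((hs σ σ i j).1 h).1

lemma lintegral_prod_exp_sq (hs : IsSiteMap supp site) (hX : IsStdGaussian P X) (t : ℝ)
    (B : Finset J) (σ : Config ℓ) :
    ∫⁻ ω, ∏ j ∈ B, ENNReal.ofReal (Real.exp (t * X (site σ j) ω ^ 2 / 2)) ∂P =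
      expSqMoment t ^ B.card := by
  have h := (hX.indep.precomp (hs.injective σ)).comp
    (fun _ x => ENNReal.ofReal (Real.exp (t * x ^ 2 / 2))) (fun _ => by fun_prop)
  have h' := lintegral_prod_eq_prod_lintegral_of_indepFun B
    (fun j ω => ENNReal.ofReal (Real.exp (t * X (site σ j) ω ^ 2 / 2))) h
    (fun j => by have := hX.measurable (site σ j); fun_prop)
  rw [h', ← Finset.prod_const]
  refine Finset.prod_congr rfl fun j _ => ?_
  rw [expSqMoment, ← hX.law (site σ j), lintegral_map (by fun_prop) (hX.measurable _)]

/-- The blocks outside `A` are free. The product form avoids subtraction of natural numbers. -/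
lemma card_agree_mul (σ : Config ℓ) (A : Finset (Fin n)) :
    (Finset.univ.filter fun τ : Config ℓ => ∀ i ∈ A, σ i = τ i).card * 2 ^ ∑ i ∈ A, ℓ i =
      2 ^ ∑ i, ℓ i := by
  have h : (Finset.univ.filter fun τ : Config ℓ => ∀ i ∈ A, σ i = τ i) =
      Fintype.piFinset fun i => if i ∈ A then {σ i} else Finset.univ := by
    ext τ
    simp only [Finset.mem_filter, Finset.mem_univ, true_and, Fintype.mem_piFinset]
    refine forall_congr' fun i => ?_
    by_cases hi : i ∈ A <;> simp [hi, eq_comm]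
  have h2 : ∀ i, (if i ∈ A then {σ i} else Finset.univ : Finset (Block (ℓ i))).card =
      if i ∈ A then 1 else 2 ^ ℓ i := by
    intro i
    by_cases hi : i ∈ A <;> simp [hi]
  rw [h, Fintype.card_piFinset, ← Finset.prod_pow_eq_pow_sum, ← Finset.prod_pow_eq_pow_sum]
  simp_rw [h2]
  rw [← Finset.prod_filter_mul_prod_filter_not Finset.univ (fun i => i ∈ A) (fun i => 2 ^ ℓ i),
    Finset.prod_ite]
  simp [mul_comm]

lemma card_config : Fintype.card (Config ℓ) = 2 ^ ∑ i, ℓ i := by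
  simp [Finset.prod_pow_eq_pow_sum]

/-! ### First-moment bound on the squared energies -/

variable [Fintype J]

/-- The sum over all configurations of `exp (t |X|² / 2)`, where `|X|²` is taken over the terms
of the Hamiltonian that only depend on the blocks in `A`. -/
noncomputable def expSqSum (supp : J → Finset (Fin n)) (site : Config ℓ → J → ι) (t : ℝ)
    (A : Finset (Fin n)) (x : ι → ℝ) : ℝ :=
  ∑ σ, Real.exp (t * (∑ j with supp j ⊆ A, x (site σ j) ^ 2) / 2)

/-- Markov's inequality. The expectation is additive over configurations, so only the independence
of the variables along a single configuration enters. -/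
lemma measure_le_expSqSum (hs : IsSiteMap supp site) (hX : IsStdGaussian P X) (t : ℝ)
    (A : Finset (Fin n)) {r : ℝ} (hr : 0 < r) :
    P {ω | r * 2 ^ ∑ i, ℓ i ≤ expSqSum supp site t A fun e => X e ω} ≤
      ENNReal.ofReal r⁻¹ * expSqMoment t ^ (Finset.univ.filter fun j => supp j ⊆ A).card := by
  have hmeas := hX.measurable
  set B := Finset.univ.filter fun j => supp j ⊆ A
  have hE : ∫⁻ ω, ENNReal.ofReal (expSqSum supp site t A fun e => X e ω) ∂P =
      2 ^ (∑ i, ℓ i) * expSqMoment t ^ B.card := by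
    have : ∀ ω, ENNReal.ofReal (expSqSum supp site t A fun e => X e ω) =
        ∑ σ : Config ℓ, ∏ j ∈ B, ENNReal.ofReal (Real.exp (t * X (site σ j) ω ^ 2 / 2)) := by
      intro ω
      rw [expSqSum, ENNReal.ofReal_sum_of_nonneg fun _ _ => (Real.exp_pos _).le]
      refine Finset.sum_congr rfl fun σ _ => ?_
      rw [← ENNReal.ofReal_prod_of_nonneg fun _ _ => (Real.exp_pos _).le, ← Real.exp_sum,
        Finset.mul_sum, Finset.sum_div]
    simp_rw [this]
    rw [lintegral_finsetSum _ fun σ _ => by fun_prop]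
    simp_rw [lintegral_prod_exp_sq hs hX t B, Finset.sum_const, Finset.card_univ, card_config,
      nsmul_eq_mul]
    push_cast
    rfl
  have hpos : 0 < r * 2 ^ ∑ i, ℓ i := by positivity
  have h := meas_ge_le_lintegral_div (μ := P)
    (f := fun ω => ENNReal.ofReal (expSqSum supp site t A fun e => X e ω))
    (by unfold expSqSum; fun_prop) (ε := ENNReal.ofReal (r * 2 ^ ∑ i, ℓ i))
    (by simpa using hpos) ENNReal.ofReal_ne_top
  rw [hE] at h
  refine (measure_mono fun ω hω => ENNReal.ofReal_le_ofReal hω).trans (h.trans (le_of_eq ?_))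
  rw [ENNReal.ofReal_mul hr.le, ENNReal.ofReal_pow (by norm_num), ENNReal.ofReal_ofNat,
    ENNReal.div_eq_inv_mul, ENNReal.mul_inv (by simp [hr]) (by simp),
    ENNReal.ofReal_inv_of_pos hr, mul_assoc, ← mul_assoc _ (2 ^ ∑ i, ℓ i : ℝ≥0∞),
    ENNReal.inv_mul_cancel (by simp) (by simp), one_mul]

/-- The summand of `σ` depends only on the blocks in `A`, so it occurs once for every configuration
agreeing with `σ` on `A`. Dividing by this multiplicity replaces the entropy of the whole system by
that of `A`; this is the origin of the constraint for `A` in `Feasible`. -/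
lemma exp_le_of_expSqSum_lt (hs : IsSiteMap supp site) {t r : ℝ} {A : Finset (Fin n)} {x : ι → ℝ}
    (h : expSqSum supp site t A x < r * 2 ^ ∑ i, ℓ i) (σ : Config ℓ) :
    Real.exp (t * (∑ j with supp j ⊆ A, x (site σ j) ^ 2) / 2) < r * 2 ^ ∑ i ∈ A, ℓ i := by
  have h1 : ∑ τ : Config ℓ with ∀ i ∈ A, σ i = τ i,
      Real.exp (t * (∑ j with supp j ⊆ A, x (site σ j) ^ 2) / 2) ≤ expSqSum supp site t A x := by
    rw [expSqSum]
    refine (le_of_eq (Finset.sum_congr rfl fun τ hτ => ?_)).trans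
      (Finset.sum_le_sum_of_subset_of_nonneg (Finset.filter_subset _ _)
        fun _ _ _ => (Real.exp_pos _).le)
    congr 3
    refine Finset.sum_congr rfl fun j hj => ?_
    rw [(hs σ τ j j).2 ⟨rfl, fun m hm => (Finset.mem_filter.1 hτ).2 m
      ((Finset.mem_filter.1 hj).2 hm)⟩]
  rw [Finset.sum_const, nsmul_eq_mul] at h1
  have h2 : ((Finset.univ.filter fun τ : Config ℓ => ∀ i ∈ A, σ i = τ i).card : ℝ) *
      2 ^ ∑ i ∈ A, ℓ i = 2 ^ ∑ i, ℓ i := by exact_mod_cast card_agree_mul σ A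
  have hc : (0 : ℝ) < (Finset.univ.filter fun τ : Config ℓ => ∀ i ∈ A, σ i = τ i).card := by
    exact_mod_cast Finset.card_pos.2 ⟨σ, by simp⟩
  rw [← h2] at h
  refine lt_of_mul_lt_mul_left (h1.trans_lt (h.trans_eq ?_)) hc.le
  ring

/-! ### The second moment of the number of configurations with large energy -/

lemma measureReal_inter_Ici {κ : Type*} [Fintype κ] {f : κ → ι} (hf : f.Injective)
    (hX : IsStdGaussian P X) (y : κ → ℝ) :
    P.real {ω | ∀ j, y j ≤ X (f j) ω} = ∏ j, gaussianTail (y j) := by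
  have h := (hX.indep.precomp hf).measure_inter_preimage_eq_mul Finset.univ
    (sets := fun j => Set.Ici (y j)) fun _ _ => measurableSet_Ici
  have he : {ω | ∀ j, y j ≤ X (f j) ω} =
      ⋂ j ∈ (Finset.univ : Finset κ), (fun ω => X (f j) ω) ⁻¹' Set.Ici (y j) := by
    ext ω; simp
  rw [measureReal_def, he, h, ENNReal.toReal_prod]
  refine Finset.prod_congr rfl fun j _ => ?_
  rw [gaussianTail, ← hX.law (f j), measureReal_def, Measure.map_apply (hX.measurable _)
    measurableSet_Ici]

/-- Two configurations share exactly the variables supported in their set of agreement. Shared tails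
occur once and not twice, which the inverse factors correct. -/
lemma measureReal_inter_inter (hs : IsSiteMap supp site) (hX : IsStdGaussian P X) {y : J → ℝ}
    (hy : ∀ j, 0 ≤ y j) (σ τ : Config ℓ) :
    P.real ({ω | ∀ j, y j ≤ X (site σ j) ω} ∩ {ω | ∀ j, y j ≤ X (site τ j) ω}) =
      (∏ j, gaussianTail (y j)) ^ 2 *
        ∏ j with supp j ⊆ Finset.univ.filter (fun i => σ i = τ i), (gaussianTail (y j))⁻¹ := by
  classical
  have hsh : ∀ j, supp j ⊆ Finset.univ.filter (fun i => σ i = τ i) ↔ site σ j = site τ j := by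
    intro j
    rw [hs]
    simp [Finset.subset_iff]
  -- All variables of `σ`, together with those of `τ` that are not shared: an injective family,
  -- hence independent.
  let f : J ⊕ {j // ¬ supp j ⊆ Finset.univ.filter (fun i => σ i = τ i)} → ι :=
    Sum.elim (site σ) fun j => site τ j
  have hf : f.Injective := by
    rintro (i | i) (j | j) h
    · rw [hs.injective σ h]
    · have h' : site σ i = site τ j.1 := h
      obtain rfl : i = j.1 := ((hs _ _ _ _).1 h').1
      exact absurd ((hsh _).2 h') j.2
    · have h' : site τ i.1 = site σ j := h
      obtain rfl : i.1 = j := ((hs _ _ _ _).1 h').1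
      exact absurd ((hsh _).2 h'.symm) i.2
    · rw [Subtype.ext (hs.injective τ h)]
  have h := measureReal_inter_Ici hf hX (Sum.elim y fun j => y j.1)
  have he : {ω | ∀ j, y j ≤ X (site σ j) ω} ∩ {ω | ∀ j, y j ≤ X (site τ j) ω} =
      {ω | ∀ j, Sum.elim y (fun j => y j.1) j ≤ X (f j) ω} := by
    ext ω
    simp only [Set.mem_inter_iff, Set.mem_ofPred_eq, Sum.forall, Sum.elim_inl, Sum.elim_inr, f]
    refine and_congr_right fun h1 => ⟨fun h2 j => h2 j.1, fun h2 j => ?_⟩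
    by_cases hj : supp j ⊆ Finset.univ.filter (fun i => σ i = τ i)
    · rw [← (hsh j).1 hj]
      exact h1 j
    · exact h2 ⟨j, hj⟩
  rw [he, h, Fintype.prod_sum_type]
  simp only [Sum.elim_inl, Sum.elim_inr]
  have h3 : ∏ j : {j // ¬ supp j ⊆ Finset.univ.filter (fun i => σ i = τ i)},
      gaussianTail (y j) = ∏ j with ¬ supp j ⊆ Finset.univ.filter (fun i => σ i = τ i),
        gaussianTail (y j) := by
    rw [Finset.prod_subtype (p := fun j => ¬ supp j ⊆ Finset.univ.filter (fun i => σ i = τ i))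
      (Finset.univ.filter fun j => ¬ supp j ⊆ Finset.univ.filter (fun i => σ i = τ i)) (by simp)
      fun j => gaussianTail (y j)]
  rw [h3, sq, mul_assoc]
  congr 1
  rw [← Finset.prod_filter_mul_prod_filter_not Finset.univ
    (fun j => supp j ⊆ Finset.univ.filter (fun i => σ i = τ i)) (fun j => gaussianTail (y j)),
    mul_right_comm, ← Finset.prod_mul_distrib,
    Finset.prod_congr rfl fun j _ => mul_inv_cancel₀ (gaussianTail_pos (hy j)).ne',
    Finset.prod_const_one, one_mul]

/-- The relative variance bound of the number of configurations with large energy. -/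
noncomputable def overlapSum (supp : J → Finset (Fin n)) (ℓ : Fin n → ℕ) (y : J → ℝ) : ℝ :=
  ∑ A : Finset (Fin n) with A.Nonempty,
    (2 ^ ∑ i ∈ A, ℓ i)⁻¹ * ∏ j with supp j ⊆ A, (gaussianTail (y j))⁻¹

/-- Configurations `τ` are grouped by their set `A` of agreement with `σ`. Relaxing agreement
exactly on `A` to agreement at least on `A` only adds nonnegative terms. The leading `1` is the term
`A = ∅`, whose product is empty because supports are nonempty. -/
lemma sum_overlap_le (hsupp : ∀ j, (supp j).Nonempty) {y : J → ℝ} (hy : ∀ j, 0 ≤ y j)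
    (σ : Config ℓ) :
    ∑ τ : Config ℓ, ∏ j with supp j ⊆ Finset.univ.filter (fun i => σ i = τ i),
      (gaussianTail (y j))⁻¹ ≤ 2 ^ (∑ i, ℓ i) * (1 + overlapSum supp ℓ y) := by
  set g : Finset (Fin n) → ℝ := fun A => ∏ j with supp j ⊆ A, (gaussianTail (y j))⁻¹ with hg
  have hg0 : ∀ A, 0 ≤ g A := fun A =>
    Finset.prod_nonneg fun j _ => inv_nonneg.2 (gaussianTail_pos (hy j)).le
  have hempty : g ∅ = 1 := by
    rw [hg]
    refine Finset.prod_eq_one fun j hj => ?_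
    have := (hsupp j).ne_empty
    simp_all
  have h1 : ∑ τ : Config ℓ, g (Finset.univ.filter (fun i => σ i = τ i)) ≤
      ∑ A : Finset (Fin n), ∑ τ : Config ℓ with ∀ i ∈ A, σ i = τ i, g A := by
    rw [← Finset.sum_fiberwise Finset.univ (fun τ : Config ℓ =>
      Finset.univ.filter (fun i => σ i = τ i))]
    refine Finset.sum_le_sum fun A _ => ?_
    rw [Finset.sum_congr rfl fun τ hτ => by rw [(Finset.mem_filter.1 hτ).2]]
    refine Finset.sum_le_sum_of_subset_of_nonneg ?_ fun _ _ _ => hg0 A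
    intro τ hτ
    simp only [Finset.mem_filter, Finset.mem_univ, true_and] at hτ ⊢
    subst hτ
    simp
  refine h1.trans (le_of_eq ?_)
  have h2 : ∀ A : Finset (Fin n), ∑ τ : Config ℓ with ∀ i ∈ A, σ i = τ i, g A =
      2 ^ (∑ i, ℓ i) * ((2 ^ ∑ i ∈ A, ℓ i)⁻¹ * g A) := by
    intro A
    have h3 : ((Finset.univ.filter fun τ : Config ℓ => ∀ i ∈ A, σ i = τ i).card : ℝ) *
      2 ^ ∑ i ∈ A, ℓ i = 2 ^ ∑ i, ℓ i := by exact_mod_cast card_agree_mul σ A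
    rw [Finset.sum_const, nsmul_eq_mul, ← h3]
    field_simp
  simp_rw [h2]
  rw [← Finset.mul_sum, overlapSum,
    ← Finset.sum_filter_add_sum_filter_not _ (fun A : Finset (Fin n) => A.Nonempty), add_comm]
  congr 2
  rw [Finset.sum_eq_single ∅]
  · simp [hempty]
  · intro A hA hA'
    simp [hA'] at hA
  · simp

/-- Chebyshev's inequality at half the mean, whence the factor `4`; the second moment is at most `1
+ overlapSum` times the squared mean. -/
lemma measure_card_large_le [IsProbabilityMeasure P] (hsupp : ∀ j, (supp j).Nonempty)
    (hs : IsSiteMap supp site) (hX : IsStdGaussian P X) {y : J → ℝ} (hy : ∀ j, 0 ≤ y j) :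
    P {ω | ((Finset.univ.filter fun σ : Config ℓ => ∀ j, y j ≤ X (site σ j) ω).card : ℝ) <
        2 ^ (∑ i, ℓ i) * (∏ j, gaussianTail (y j)) / 2} ≤
      ENNReal.ofReal (4 * overlapSum supp ℓ y) := by
  classical
  set q := ∏ j, gaussianTail (y j) with hq
  have hqpos : 0 < q := Finset.prod_pos fun j _ => gaussianTail_pos (hy j)
  set m : ℝ := 2 ^ (∑ i, ℓ i) * q with hm
  have hmpos : 0 < m := by positivity
  let E : Config ℓ → Set Ω := fun σ => {ω | ∀ j, y j ≤ X (site σ j) ω}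
  have hE : ∀ σ, MeasurableSet (E σ) := by
    intro σ
    have : E σ = ⋂ j, X (site σ j) ⁻¹' Set.Ici (y j) := by ext; simp [E]
    rw [this]
    exact MeasurableSet.iInter fun j => hX.measurable _ measurableSet_Ici
  let C : Ω → ℝ := fun ω => ∑ σ : Config ℓ, (E σ).indicator 1 ω
  have hC : ∀ ω, C ω =
      ((Finset.univ.filter fun σ : Config ℓ => ∀ j, y j ≤ X (site σ j) ω).card : ℝ) := by
    intro ω
    simp [C, E, Set.indicator_apply]
  have hind : ∀ σ, MemLp ((E σ).indicator (1 : Ω → ℝ)) 2 P := fun σ =>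
    (memLp_const (1 : ℝ)).indicator (hE σ)
  have hmem : MemLp C 2 P := memLp_finsetSum _ fun σ _ => hind σ
  have hmean : ∫ ω, C ω ∂P = m := by
    rw [integral_finsetSum _ fun σ _ => (hind σ).integrable (by norm_num)]
    simp_rw [integral_indicator_one (hE _)]
    rw [Finset.sum_congr rfl fun σ _ => measureReal_inter_Ici (hs.injective σ) hX y]
    rw [Finset.sum_const, Finset.card_univ, card_config, nsmul_eq_mul, ← hq, hm]
    push_cast
    rfl
  have hsq : ∫ ω, (C ^ 2) ω ∂P ≤ m ^ 2 * (1 + overlapSum supp ℓ y) := by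
    have h1 : ∀ ω, (C ^ 2) ω = ∑ σ : Config ℓ, ∑ τ : Config ℓ, (E σ ∩ E τ).indicator 1 ω := by
      intro ω
      simp only [Pi.pow_apply, C, sq, Finset.sum_mul_sum]
      refine Finset.sum_congr rfl fun σ _ => Finset.sum_congr rfl fun τ _ => ?_
      rw [Set.inter_indicator_one]
      rfl
    simp_rw [h1]
    have h3 : ∀ σ τ : Config ℓ, Integrable ((E σ ∩ E τ).indicator (1 : Ω → ℝ)) P := fun σ τ =>
      (integrable_const (1 : ℝ)).indicator ((hE σ).inter (hE τ))
    rw [integral_finsetSum _ fun σ _ => integrable_finsetSum _ fun τ _ => h3 σ τ]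
    have h2 : ∀ σ : Config ℓ, ∫ ω, ∑ τ : Config ℓ, (E σ ∩ E τ).indicator (1 : Ω → ℝ) ω ∂P ≤
        q ^ 2 * (2 ^ (∑ i, ℓ i) * (1 + overlapSum supp ℓ y)) := by
      intro σ
      rw [integral_finsetSum _ fun τ _ => h3 σ τ]
      simp_rw [integral_indicator_one ((hE _).inter (hE _))]
      rw [Finset.sum_congr rfl fun τ _ => measureReal_inter_inter hs hX hy σ τ, ← Finset.mul_sum]
      exact mul_le_mul_of_nonneg_left (sum_overlap_le hsupp hy σ) (by positivity)
    refine (Finset.sum_le_sum fun σ _ => h2 σ).trans (le_of_eq ?_)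
    rw [Finset.sum_const, Finset.card_univ, card_config, nsmul_eq_mul, hm]
    push_cast
    ring
  have hvar : Var[C; P] ≤ m ^ 2 * overlapSum supp ℓ y := by
    rw [variance_eq_sub hmem, hmean]
    linarith
  have hcheb := meas_ge_le_variance_div_sq hmem (half_pos hmpos)
  rw [hmean] at hcheb
  refine (measure_mono fun ω hω => ?_).trans (hcheb.trans (ENNReal.ofReal_le_ofReal ?_))
  · simp only [Set.mem_ofPred_eq, ← hC] at hω ⊢
    rw [abs_sub_comm]
    exact le_trans (by linarith) (le_abs_self _)
  · rw [div_le_iff₀ (by positivity)]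
    calc _ ≤ _ := hvar
      _ = _ := by ring

end FiniteVolume

/-! ### The variational problem -/

section Variational

variable {n : ℕ} {J : Type*} [Fintype J]

/-- The exponential growth rate (relative to `2 ^ N`) of the contribution to the partition
function of the configurations with energies `x`. -/
noncomputable def gain (c : J → ℝ) (β : ℝ) (x : J → ℝ) : ℝ := ∑ j, (β * c j * x j - x j ^ 2 / 2)

/-- The energies `x` that occur in the limit of infinite volume. -/
def Feasible (supp : J → Finset (Fin n)) (p : Fin n → ℝ) (x : J → ℝ) : Prop :=
  (∀ j, 0 ≤ x j) ∧ ∀ A, ∑ j with supp j ⊆ A, x j ^ 2 / 2 ≤ (∑ i ∈ A, p i) * Real.log 2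

/-- The constraints of `Feasible` with strict inequalities. -/
def StrictlyFeasible (supp : J → Finset (Fin n)) (p : Fin n → ℝ) (x : J → ℝ) : Prop :=
  (∀ j, 0 ≤ x j) ∧ ∀ A : Finset (Fin n), A.Nonempty →
    ∑ j with supp j ⊆ A, x j ^ 2 / 2 < (∑ i ∈ A, p i) * Real.log 2

/-- The supremum of `gain` over the feasible energies. -/
noncomputable def maxGain (supp : J → Finset (Fin n)) (p : Fin n → ℝ) (c : J → ℝ) (β : ℝ) : ℝ :=
  sSup (gain c β '' {x | Feasible supp p x})

variable {supp : J → Finset (Fin n)} {p : Fin n → ℝ} {c : J → ℝ} {β : ℝ}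

lemma gain_le_sum_sq (x : J → ℝ) : gain c β x ≤ ∑ j, (β * c j) ^ 2 / 2 :=
  Finset.sum_le_sum fun j _ => by nlinarith [sq_nonneg (β * c j - x j)]

lemma bddAbove_gain : BddAbove (gain c β '' {x | Feasible supp p x}) :=
  ⟨∑ j, (β * c j) ^ 2 / 2, by rintro _ ⟨x, -, rfl⟩; exact gain_le_sum_sq x⟩

lemma gain_le_maxGain {x : J → ℝ} (hx : Feasible supp p x) : gain c β x ≤ maxGain supp p c β :=
  le_csSup bddAbove_gain ⟨x, hx, rfl⟩

lemma feasible_zero (hp : ∀ i, 0 < p i) : Feasible supp p (0 : J → ℝ) := by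
  refine ⟨fun _ => le_rfl, fun A => ?_⟩
  simpa using mul_nonneg (Finset.sum_nonneg fun i _ => (hp i).le) (Real.log_nonneg one_le_two)

lemma maxGain_le (hp : ∀ i, 0 < p i) {M : ℝ} (h : ∀ x, Feasible supp p x → gain c β x ≤ M) :
    maxGain supp p c β ≤ M :=
  csSup_le ⟨_, 0, feasible_zero hp, rfl⟩ (by rintro _ ⟨x, hx, rfl⟩; exact h x hx)

/-- Shrinking `x` slightly makes every constraint involving a positive coordinate strict; in the
others the left side is zero and `p(A) log 2 > 0`. Rational points form a countable set, so one null
set will serve for all of them and for all `β`. -/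
lemma exists_rat_strictlyFeasible (hp : ∀ i, 0 < p i) (hc : ∀ j, 0 ≤ c j) (hβ : 0 < β)
    {x : J → ℝ} (hx : Feasible supp p x) {ε : ℝ} (hε : 0 < ε) :
    ∃ r : J → ℚ, StrictlyFeasible supp p (fun j => (r j : ℝ)) ∧
      gain c β x - ε < gain c β fun j => (r j : ℝ) := by
  set S := ∑ j, β * c j * x j with hS
  have hS0 : 0 ≤ S := Finset.sum_nonneg fun j _ =>
    mul_nonneg (mul_nonneg hβ.le (hc j)) (hx.1 j)
  -- Chosen so that `η < 1` and `η * S < ε`: the linear part loses at most `η * S`, and the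
  -- quadratic part can only improve.
  set η := ε / (S + ε + 1) with hη
  have hη0 : 0 < η := by positivity
  have hη1 : η < 1 := by rw [hη, div_lt_one (by positivity)]; linarith
  have hηS : η * S < ε := by
    rw [hη, div_mul_eq_mul_div, div_lt_iff₀ (by positivity)]
    nlinarith
  have hr : ∀ j, ∃ r : ℚ, (1 - η) * x j ≤ r ∧ (r : ℝ) ≤ x j ∧ (0 < x j → (r : ℝ) < x j) := by
    intro j
    rcases (hx.1 j).eq_or_lt with h | h
    · exact ⟨0, by simp [← h]⟩
    · obtain ⟨r, h1, h2⟩ := exists_rat_btwn (show (1 - η) * x j < x j by nlinarith)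
      exact ⟨r, h1.le, h2.le, fun _ => h2⟩
  choose r hr1 hr2 hr3 using hr
  have hr0 : ∀ j, (0 : ℝ) ≤ r j := fun j => le_trans (mul_nonneg (by linarith) (hx.1 j)) (hr1 j)
  have hsq : ∀ j, (r j : ℝ) ^ 2 ≤ x j ^ 2 := fun j => pow_le_pow_left₀ (hr0 j) (hr2 j) 2
  refine ⟨r, ⟨hr0, fun A hA => ?_⟩, ?_⟩
  · by_cases h : ∃ j, supp j ⊆ A ∧ 0 < x j
    · obtain ⟨j, hj, hxj⟩ := h
      refine lt_of_lt_of_le (Finset.sum_lt_sum (fun j _ => ?_) ⟨j, by simpa using hj, ?_⟩) (hx.2 A)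
      · linarith [hsq j]
      · linarith [pow_lt_pow_left₀ (hr3 j hxj) (hr0 j) two_ne_zero]
    · push Not at h
      rw [Finset.sum_eq_zero]
      · exact mul_pos (Finset.sum_pos (fun i _ => hp i) hA) (Real.log_pos one_lt_two)
      · intro j hj
        have : (r j : ℝ) = 0 := le_antisymm ((hr2 j).trans (h j (by simpa using hj))) (hr0 j)
        simp [this]
  · have h1 : gain c β x - η * S ≤ gain c β fun j => (r j : ℝ) := by
      rw [gain, gain, hS, Finset.mul_sum, ← Finset.sum_sub_distrib]
      refine Finset.sum_le_sum fun j _ => ?_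
      have := mul_le_mul_of_nonneg_left (hr1 j) (mul_nonneg hβ.le (hc j))
      linarith [hsq j]
    linarith

end Variational

/-! ### The infinite-volume limit -/

section Limit

variable {n : ℕ} {J : Type*} [Fintype J] {supp : J → Finset (Fin n)} {p : Fin n → ℝ} {c : J → ℝ}
  {ℓ : ℕ → Fin n → ℕ} {ι : ℕ → Type*} {site : (N : ℕ) → Config (ℓ N) → J → ι N}
  {Ω : Type*} [MeasurableSpace Ω] {P : Measure Ω} {X : (N : ℕ) → ι N → Ω → ℝ}

/-- Borel–Cantelli: the threshold factor `N ^ 2` has summable inverses and is negligible on the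
exponential scale. -/
lemma ae_eventually_expSqSum_lt (hs : ∀ N, IsSiteMap supp (site N))
    (hX : ∀ N, n ≤ N → IsStdGaussian P (X N)) {t : ℝ} (ht : t < 1) (A : Finset (Fin n)) :
    ∀ᵐ ω ∂P, ∀ᶠ N : ℕ in atTop,
      expSqSum supp (site N) t A (fun e => X N e ω) < (N : ℝ) ^ 2 * 2 ^ ∑ i, ℓ N i := by
  set b := (Finset.univ.filter fun j => supp j ⊆ A).card
  let s : ℕ → Set Ω := fun N => {ω | (n ≤ N ∧ 1 ≤ N) ∧
    (N : ℝ) ^ 2 * 2 ^ ∑ i, ℓ N i ≤ expSqSum supp (site N) t A (fun e => X N e ω)}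
  have hbound : ∀ N, P (s N) ≤ ENNReal.ofReal (1 / (N : ℝ) ^ 2) * expSqMoment t ^ b := by
    intro N
    by_cases hN : n ≤ N ∧ 1 ≤ N
    · have hN' : (0 : ℝ) < (N : ℝ) ^ 2 := by
        have : (0 : ℝ) < N := by exact_mod_cast hN.2
        positivity
      rw [one_div]
      exact (measure_mono fun ω hω => hω.2).trans
        (measure_le_expSqSum (hs N) (hX N hN.1) t A hN')
    · have : s N = ∅ := Set.eq_empty_of_forall_notMem fun ω hω => hN hω.1
      simp [this]
  have hsum : ∑' N, P (s N) ≠ ∞ := by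
    refine ne_top_of_le_ne_top ?_ (ENNReal.tsum_le_tsum hbound)
    rw [ENNReal.tsum_mul_right]
    refine ENNReal.mul_ne_top ?_ (ENNReal.pow_ne_top (expSqMoment_lt_top ht).ne)
    exact (Real.summable_one_div_nat_pow.2 one_lt_two).tsum_ofReal_ne_top
  filter_upwards [ae_eventually_notMem hsum] with ω hω
  filter_upwards [hω, eventually_ge_atTop n, eventually_ge_atTop 1] with N h1 h2 h3
  by_contra h
  exact h1 ⟨⟨h2, h3⟩, not_lt.1 h⟩

lemma tendsto_sum_div (hlim : ∀ i, Tendsto (fun N => (ℓ N i : ℝ) / N) atTop (𝓝 (p i)))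
    (A : Finset (Fin n)) :
    Tendsto (fun N : ℕ => ((∑ i ∈ A, ℓ N i : ℕ) : ℝ) / N) atTop (𝓝 (∑ i ∈ A, p i)) := by
  simp_rw [Nat.cast_sum, Finset.sum_div]
  exact tendsto_finsetSum _ fun i _ => hlim i

lemma tendsto_log_div : Tendsto (fun N : ℕ => Real.log N / N) atTop (𝓝 0) :=
  (Real.isLittleO_log_id_atTop.comp_tendsto tendsto_natCast_atTop_atTop).tendsto_div_nhds_zero

lemma tendsto_tail_exponent (x C : ℝ) :
    Tendsto (fun N : ℕ => ((√N * x + 1) ^ 2 / 2 + C) / N) atTop (𝓝 (x ^ 2 / 2)) := by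
  have h1 : Tendsto (fun N : ℕ => x ^ 2 / 2 + x * (√(N : ℝ))⁻¹ + (1 / 2 + C) * (N : ℝ)⁻¹) atTop
      (𝓝 (x ^ 2 / 2 + x * 0 + (1 / 2 + C) * 0)) := by
    refine ((tendsto_const_nhds).add (tendsto_const_nhds.mul ?_)).add
      (tendsto_const_nhds.mul ?_)
    · exact tendsto_inv_atTop_zero.comp (Real.tendsto_sqrt_atTop.comp tendsto_natCast_atTop_atTop)
    · exact tendsto_inv_atTop_zero.comp tendsto_natCast_atTop_atTop
  simp only [mul_zero, add_zero] at h1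
  refine h1.congr' ?_
  filter_upwards [eventually_ge_atTop 1] with N hN
  have hN' : (0 : ℝ) < N := by exact_mod_cast hN
  have hsq : √(N : ℝ) ^ 2 = N := Real.sq_sqrt hN'.le
  have hs : 0 < √(N : ℝ) := Real.sqrt_pos.2 hN'
  nth_rewrite 2 4 [← hsq]
  field_simp
  ring

/-- Lower bound for the logarithm of `gaussianTail`. -/
lemma neg_le_log_gaussianTail {y : ℝ} (hy : 0 ≤ y) :
    -((y + 1) ^ 2 / 2 + Real.log √(2 * Real.pi)) ≤ Real.log (gaussianTail y) := by
  have h := Real.log_le_log (by positivity) (le_gaussianTail hy)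
  rw [Real.log_mul (by positivity) (by positivity), Real.log_exp, Real.log_inv] at h
  linarith

/-- The term of `A` decays like `exp (-N d)`, where `d > 0` is the slack of the constraint for `A`;
half of `d` absorbs the subexponential errors. -/
lemma summable_overlapSum (hlim : ∀ i, Tendsto (fun N => (ℓ N i : ℝ) / N) atTop (𝓝 (p i)))
    {x : J → ℝ} (hx : StrictlyFeasible supp p x) :
    Summable fun N : ℕ => overlapSum supp (ℓ N) fun j => √N * x j := by
  unfold overlapSum
  refine summable_sum fun A hA => ?_
  have hA' := hx.2 A (Finset.mem_filter.1 hA).2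
  set d := (∑ i ∈ A, p i) * Real.log 2 - ∑ j with supp j ⊆ A, x j ^ 2 / 2 with hd
  have hd0 : 0 < d := by linarith
  have hlimA : Tendsto (fun N : ℕ => (∑ j with supp j ⊆ A,
      ((√N * x j + 1) ^ 2 / 2 + Real.log √(2 * Real.pi)) / N) -
      ((∑ i ∈ A, ℓ N i : ℕ) : ℝ) / N * Real.log 2) atTop (𝓝 (-d)) := by
    rw [hd, neg_sub]
    exact (tendsto_finsetSum _ fun j _ => tendsto_tail_exponent _ _).sub
      ((tendsto_sum_div hlim A).mul_const _)
  refine Summable.of_norm_bounded_eventually_nat (g := fun N : ℕ => Real.exp (-(d / 2)) ^ N)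
    (summable_geometric_of_lt_one (Real.exp_pos _).le (by simpa using hd0)) ?_
  filter_upwards [hlimA.eventually_le_const (show -d < -(d / 2) by linarith),
    eventually_ge_atTop 1] with N hN hN1
  have hN' : (0 : ℝ) < N := by exact_mod_cast hN1
  have hq : ∀ j, 0 < gaussianTail (√N * x j) := fun j =>
    gaussianTail_pos (mul_nonneg (Real.sqrt_nonneg _) (hx.1 j))
  have hpos : 0 < ((2 : ℝ) ^ ∑ i ∈ A, ℓ N i)⁻¹ *
      ∏ j with supp j ⊆ A, (gaussianTail (√N * x j))⁻¹ :=
    mul_pos (by positivity) (Finset.prod_pos fun j _ => inv_pos.2 (hq j))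
  rw [Real.norm_of_nonneg hpos.le, ← Real.exp_nat_mul]
  refine (Real.log_le_iff_le_exp hpos).1 ?_
  rw [Real.log_mul (by positivity) (Finset.prod_pos fun j _ => inv_pos.2 (hq j)).ne',
    Real.log_inv, Real.log_pow, Real.log_prod fun j _ => (inv_pos.2 (hq j)).ne']
  rw [← Finset.sum_div, div_mul_eq_mul_div, ← sub_div, div_le_iff₀ hN'] at hN
  have : ∑ j with supp j ⊆ A, Real.log (gaussianTail (√N * x j))⁻¹ ≤
      ∑ j with supp j ⊆ A, ((√N * x j + 1) ^ 2 / 2 + Real.log √(2 * Real.pi)) := by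
    refine Finset.sum_le_sum fun j _ => ?_
    rw [Real.log_inv]
    linarith [neg_le_log_gaussianTail (mul_nonneg (Real.sqrt_nonneg N) (hx.1 j))]
  linarith

lemma ae_eventually_le_card_large [IsProbabilityMeasure P] (hsupp : ∀ j, (supp j).Nonempty)
    (hs : ∀ N, IsSiteMap supp (site N)) (hX : ∀ N, n ≤ N → IsStdGaussian P (X N))
    (hlim : ∀ i, Tendsto (fun N => (ℓ N i : ℝ) / N) atTop (𝓝 (p i)))
    {x : J → ℝ} (hx : StrictlyFeasible supp p x) :
    ∀ᵐ ω ∂P, ∀ᶠ N : ℕ in atTop, 2 ^ (∑ i, ℓ N i) * (∏ j, gaussianTail (√N * x j)) / 2 ≤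
      ((Finset.univ.filter fun σ : Config (ℓ N) =>
        ∀ j, √N * x j ≤ X N (site N σ j) ω).card : ℝ) := by
  have hy : ∀ N : ℕ, ∀ j, 0 ≤ √(N : ℝ) * x j := fun N j => mul_nonneg (Real.sqrt_nonneg _) (hx.1 j)
  let s : ℕ → Set Ω := fun N => {ω | n ≤ N ∧ ((Finset.univ.filter fun σ : Config (ℓ N) =>
        ∀ j, √N * x j ≤ X N (site N σ j) ω).card : ℝ) <
        2 ^ (∑ i, ℓ N i) * (∏ j, gaussianTail (√N * x j)) / 2}
  have hbound : ∀ N, P (s N) ≤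
      ENNReal.ofReal (4 * overlapSum supp (ℓ N) fun j => √N * x j) := by
    intro N
    by_cases hN : n ≤ N
    · exact (measure_mono fun ω hω => hω.2).trans
        (measure_card_large_le hsupp (hs N) (hX N hN) (hy N))
    · have : s N = ∅ := Set.eq_empty_of_forall_notMem fun ω hω => hN hω.1
      simp [this]
  have hsum : ∑' N, P (s N) ≠ ∞ :=
    ne_top_of_le_ne_top ((summable_overlapSum hlim hx).mul_left 4).tsum_ofReal_ne_top
      (ENNReal.tsum_le_tsum hbound)
  filter_upwards [ae_eventually_notMem hsum] with ω hω
  filter_upwards [hω, eventually_ge_atTop n] with N h1 h2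
  by_contra h
  exact h1 ⟨h2, not_le.1 h⟩

/-! ### Upper and lower bounds for the free energy -/

variable {β : ℝ}

/-- The logarithm of the partition function for the value `x` of the field. -/
noncomputable def logPartition {ℓ : Fin n → ℕ} {ι : Type*} (c : J → ℝ) (site : Config ℓ → J → ι)
    (N : ℕ) (β : ℝ) (x : ι → ℝ) : ℝ :=
  Real.log (∑ σ, Real.exp (β * √N * ∑ j, c j * x (site σ j)))

/-- No discretisation of energies is needed. For each `σ` the vector `t * |X_j(σ)| / √N` is
feasible, so its gain is at most `M = maxGain`. Rearranged, this bounds the exponent by `N M / t + t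
|X(σ)|² / 2`, and the exponentials of the quadratic terms add up to `expSqSum` for the full index
set, which is below `N² 2^N`. -/
lemma logPartition_le (hsupp : ∀ j, (supp j).Nonempty) (hs : ∀ N, IsSiteMap supp (site N))
    (hℓ : ∀ N, n ≤ N → ∑ i, ℓ N i = N) (hp : ∀ i, 0 < p i) (hc : ∀ j, 0 ≤ c j)
    (hlim : ∀ i, Tendsto (fun N => (ℓ N i : ℝ) / N) atTop (𝓝 (p i)))
    {x : (N : ℕ) → ι N → ℝ} {t : ℝ} (ht0 : 0 < t) (ht : t < 1)
    (h : ∀ A, ∀ᶠ N : ℕ in atTop,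
      expSqSum supp (site N) t A (x N) < (N : ℝ) ^ 2 * 2 ^ ∑ i, ℓ N i)
    (hβ : 0 < β) {b : ℝ} (hb : Real.log 2 + maxGain supp p c β / t < b) :
    ∀ᶠ N : ℕ in atTop, 1 / N * logPartition c (site N) N β (x N) < b := by
  have hlog2 := Real.log_pos one_lt_two
  -- Since `t < 1` and `p(A) > 0`, division by `t` leaves room for the error `2 log N / N` due to
  -- the factor `N ^ 2`.
  have hA : ∀ᶠ N : ℕ in atTop, ∀ A : Finset (Fin n), A.Nonempty →
      ((∑ i ∈ A, ℓ N i : ℕ) : ℝ) / N * Real.log 2 + 2 * (Real.log N / N) ≤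
        (∑ i ∈ A, p i) * Real.log 2 / t := by
    refine eventually_all.2 fun A => ?_
    by_cases hA : A.Nonempty
    · have hlimA := ((tendsto_sum_div hlim A).mul_const (Real.log 2)).add
        (tendsto_log_div.const_mul 2)
      have hpA : 0 < (∑ i ∈ A, p i) * Real.log 2 :=
        mul_pos (Finset.sum_pos (fun i _ => hp i) hA) hlog2
      filter_upwards [hlimA.eventually_le_const
        (show (∑ i ∈ A, p i) * Real.log 2 + 2 * 0 < (∑ i ∈ A, p i) * Real.log 2 / t by
          rw [mul_zero, add_zero, lt_div_iff₀ ht0]; nlinarith)] with N hN _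
      exact hN
    · exact Eventually.of_forall fun _ h => absurd h hA
  have hlast : Tendsto (fun N : ℕ => Real.log 2 + maxGain supp p c β / t + 2 * (Real.log N / N))
      atTop (𝓝 (Real.log 2 + maxGain supp p c β / t + 2 * 0)) :=
    tendsto_const_nhds.add (tendsto_log_div.const_mul 2)
  rw [mul_zero, add_zero] at hlast
  filter_upwards [hA, eventually_all.2 h, hlast.eventually_lt_const hb, eventually_ge_atTop n,
    eventually_ge_atTop 1] with N hN hN2 hN3 hN4 hN5
  have hN' : (0 : ℝ) < N := by exact_mod_cast hN5
  have hsN : 0 < √(N : ℝ) := Real.sqrt_pos.2 hN'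
  have hsq : √(N : ℝ) ^ 2 = N := Real.sq_sqrt hN'.le
  set M := maxGain supp p c β
  have hterm : ∀ σ : Config (ℓ N), β * √N * ∑ j, c j * x N (site N σ j) ≤
      N * (M / t) + t * (∑ j, x N (site N σ j) ^ 2) / 2 := by
    intro σ
    let z : J → ℝ := fun j => x N (site N σ j)
    have hfeas : Feasible supp p fun j => t * |z j| / √N := by
      refine ⟨fun j => by positivity, fun A => ?_⟩
      rcases A.eq_empty_or_nonempty with rfl | hA
      · rw [Finset.sum_eq_zero]
        · simp
        · intro j hj
          exact absurd (Finset.subset_empty.1 (Finset.mem_filter.1 hj).2) (hsupp j).ne_empty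
      · have h1 := Real.log_lt_log (Real.exp_pos _) (exp_le_of_expSqSum_lt (hs N) (hN2 A) σ)
        rw [Real.log_exp, Real.log_mul (by positivity) (by positivity), Real.log_pow,
          Real.log_pow] at h1
        have h2 := hN A hA
        rw [div_mul_eq_mul_div, mul_div_assoc', ← add_div, div_le_div_iff₀ hN' ht0] at h2
        have h3 : ∑ j with supp j ⊆ A, (t * |z j| / √N) ^ 2 / 2 =
            t * (t * (∑ j with supp j ⊆ A, z j ^ 2) / 2) / N := by
          rw [Finset.mul_sum, Finset.sum_div, Finset.mul_sum, Finset.sum_div]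
          refine Finset.sum_congr rfl fun j _ => ?_
          rw [div_pow, mul_pow, sq_abs, hsq]
          ring
        rw [h3, div_le_iff₀ hN']
        push_cast at h1 h2
        have h4 := mul_le_mul_of_nonneg_left h1.le ht0.le
        simp only [z]
        linarith
    have hg : gain c β _ ≤ M := gain_le_maxGain hfeas
    have h5 : gain c β (fun j => t * |z j| / √N) =
        t * (β * (∑ j, c j * |z j|) / √N) - t ^ 2 * (∑ j, z j ^ 2) / 2 / N := by
      rw [gain, Finset.sum_sub_distrib]
      congr 1
      · rw [Finset.mul_sum, Finset.sum_div, Finset.mul_sum]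
        exact Finset.sum_congr rfl fun j _ => by ring
      · rw [Finset.mul_sum, Finset.sum_div, Finset.sum_div]
        refine Finset.sum_congr rfl fun j _ => ?_
        rw [div_pow, mul_pow, sq_abs, hsq]
        ring
    rw [h5] at hg
    have h6 : ∑ j, c j * x N (site N σ j) ≤ ∑ j, c j * |z j| :=
      Finset.sum_le_sum fun j _ => mul_le_mul_of_nonneg_left (le_abs_self _) (hc j)
    have h7 : β * √N * ∑ j, c j * |z j| = N * (β * (∑ j, c j * |z j|) / √N) := by
      nth_rewrite 2 [← hsq]
      field_simp
    have h8 : β * (∑ j, c j * |z j|) / √N ≤ M / t + t * (∑ j, z j ^ 2) / 2 / N := by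
      have : t * (β * (∑ j, c j * |z j|) / √N) ≤ t * (M / t + t * (∑ j, z j ^ 2) / 2 / N) := by
        have h9 : t * (M / t) = M := by field_simp
        have h10 : t * (t * (∑ j, z j ^ 2) / 2 / N) = t ^ 2 * (∑ j, z j ^ 2) / 2 / N := by ring
        rw [mul_add, h9, h10]
        linarith only [hg]
      exact le_of_mul_le_mul_left this ht0
    calc β * √N * ∑ j, c j * x N (site N σ j) ≤ β * √N * ∑ j, c j * |z j| := by gcongr
      _ = N * (β * (∑ j, c j * |z j|) / √N) := h7
      _ ≤ N * (M / t + t * (∑ j, z j ^ 2) / 2 / N) := by gcongr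
      _ = N * (M / t) + t * (∑ j, x N (site N σ j) ^ 2) / 2 := by
        simp only [z]
        field_simp
  have hZ : ∑ σ, Real.exp (β * √N * ∑ j, c j * x N (site N σ j)) ≤
      Real.exp (N * (M / t)) * ((N : ℝ) ^ 2 * 2 ^ N) := by
    refine (Finset.sum_le_sum fun σ _ => Real.exp_le_exp.2 (hterm σ)).trans ?_
    simp_rw [Real.exp_add]
    rw [← Finset.mul_sum]
    have h1 := hN2 Finset.univ
    rw [hℓ N hN4, expSqSum] at h1
    simp only [Finset.subset_univ, Finset.filter_true] at h1
    exact mul_le_mul_of_nonneg_left h1.le (Real.exp_pos _).le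
  refine lt_of_le_of_lt ?_ hN3
  rw [one_div, inv_mul_le_iff₀ hN', logPartition]
  refine (Real.log_le_log (Finset.sum_pos (fun _ _ => Real.exp_pos _)
    Finset.univ_nonempty) hZ).trans (le_of_eq ?_)
  rw [Real.log_mul (by positivity) (by positivity), Real.log_exp,
    Real.log_mul (by positivity) (by positivity), Real.log_pow, Real.log_pow]
  push_cast
  field_simp
  ring

/-- Only configurations with all energies above `√N z_j` are kept. Each contributes at least `exp (N
∑ β c_j z_j)`, and to exponential order there are at least `2 ^ N exp (-N ∑ z_j² / 2)` of them. -/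
lemma le_logPartition (hℓ : ∀ N, n ≤ N → ∑ i, ℓ N i = N) (hc : ∀ j, 0 ≤ c j)
    {x : (N : ℕ) → ι N → ℝ} {z : J → ℝ} (hz : ∀ j, 0 ≤ z j)
    (h : ∀ᶠ N : ℕ in atTop, 2 ^ (∑ i, ℓ N i) * (∏ j, gaussianTail (√N * z j)) / 2 ≤
      ((Finset.univ.filter fun σ : Config (ℓ N) =>
        ∀ j, √N * z j ≤ x N (site N σ j)).card : ℝ))
    (hβ : 0 < β) {b : ℝ} (hb : b < Real.log 2 + gain c β z) :
    ∀ᶠ N : ℕ in atTop, b < 1 / N * logPartition c (site N) N β (x N) := by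
  have hlim : Tendsto (fun N : ℕ => Real.log 2 -
      (∑ j, ((√N * z j + 1) ^ 2 / 2 + Real.log √(2 * Real.pi)) / N) + ∑ j, β * c j * z j -
      Real.log 2 * (N : ℝ)⁻¹) atTop
      (𝓝 (Real.log 2 - (∑ j, z j ^ 2 / 2) + (∑ j, β * c j * z j) - Real.log 2 * 0)) :=
    ((tendsto_const_nhds.sub (tendsto_finsetSum _ fun j _ => tendsto_tail_exponent _ _)).add
      tendsto_const_nhds).sub
      ((tendsto_inv_atTop_zero.comp tendsto_natCast_atTop_atTop).const_mul _)
  have hb' : b < Real.log 2 - (∑ j, z j ^ 2 / 2) + (∑ j, β * c j * z j) - Real.log 2 * 0 := by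
    rw [gain, Finset.sum_sub_distrib] at hb
    linarith
  filter_upwards [h, hlim.eventually_const_lt hb', eventually_ge_atTop n,
    eventually_ge_atTop 1] with N hN hN2 hN3 hN4
  have hN' : (0 : ℝ) < N := by exact_mod_cast hN4
  have hsq : √(N : ℝ) ^ 2 = N := Real.sq_sqrt hN'.le
  have hq : ∀ j, 0 < gaussianTail (√N * z j) := fun j =>
    gaussianTail_pos (mul_nonneg (Real.sqrt_nonneg _) (hz j))
  have hprod : 0 < ∏ j, gaussianTail (√N * z j) := Finset.prod_pos fun j _ => hq j
  have hZ : 2 ^ N * (∏ j, gaussianTail (√N * z j)) / 2 * Real.exp (N * ∑ j, β * c j * z j) ≤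
      ∑ σ, Real.exp (β * √N * ∑ j, c j * x N (site N σ j)) := by
    rw [hℓ N hN3] at hN
    refine (mul_le_mul_of_nonneg_right hN (Real.exp_pos _).le).trans ?_
    rw [← nsmul_eq_mul, ← Finset.sum_const]
    refine (Finset.sum_le_sum fun σ hσ => ?_).trans (Finset.sum_le_sum_of_subset_of_nonneg
      (Finset.filter_subset _ _) fun _ _ _ => (Real.exp_pos _).le)
    refine Real.exp_le_exp.2 ?_
    have h1 : N * ∑ j, β * c j * z j = β * √N * ∑ j, c j * (√N * z j) := by
      rw [Finset.mul_sum, Finset.mul_sum]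
      refine Finset.sum_congr rfl fun j _ => ?_
      linear_combination -(β * c j * z j) * hsq
    rw [h1]
    refine mul_le_mul_of_nonneg_left (Finset.sum_le_sum fun j _ => ?_) (by positivity)
    exact mul_le_mul_of_nonneg_left ((Finset.mem_filter.1 hσ).2 j) (hc j)
  refine hN2.trans_le ?_
  rw [one_div, le_inv_mul_iff₀ hN', logPartition]
  refine le_trans ?_ (Real.log_le_log (by positivity) hZ)
  rw [Real.log_mul (by positivity) (by positivity), Real.log_exp,
    Real.log_div (by positivity) two_ne_zero,
    Real.log_mul (by positivity) hprod.ne', Real.log_pow, Real.log_prod fun j _ => (hq j).ne']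
  have h2 : -∑ j, ((√N * z j + 1) ^ 2 / 2 + Real.log √(2 * Real.pi)) ≤
      ∑ j, Real.log (gaussianTail (√N * z j)) := by
    rw [← Finset.sum_neg_distrib]
    exact Finset.sum_le_sum fun j _ =>
      neg_le_log_gaussianTail (mul_nonneg (Real.sqrt_nonneg N) (hz j))
  rw [← Finset.sum_div]
  have h3 : (N : ℝ) * (Real.log 2 -
      (∑ j, ((√N * z j + 1) ^ 2 / 2 + Real.log √(2 * Real.pi))) / N + ∑ j, β * c j * z j -
      Real.log 2 * (N : ℝ)⁻¹) = N * Real.log 2 -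
      (∑ j, ((√N * z j + 1) ^ 2 / 2 + Real.log √(2 * Real.pi))) + N * ∑ j, β * c j * z j -
      Real.log 2 := by
    field_simp
  rw [h3]
  linarith

/-- Almost sure convergence of the free energy, for all inverse temperatures simultaneously. -/
theorem ae_tendsto_logPartition [IsProbabilityMeasure P] (hsupp : ∀ j, (supp j).Nonempty)
    (hs : ∀ N, IsSiteMap supp (site N)) (hX : ∀ N, n ≤ N → IsStdGaussian P (X N))
    (hℓ : ∀ N, n ≤ N → ∑ i, ℓ N i = N) (hp : ∀ i, 0 < p i) (hc : ∀ j, 0 ≤ c j)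
    (hlim : ∀ i, Tendsto (fun N => (ℓ N i : ℝ) / N) atTop (𝓝 (p i))) :
    ∀ᵐ ω ∂P, ∀ β : ℝ, 0 < β →
      Tendsto (fun N : ℕ => 1 / (N : ℝ) * logPartition c (site N) N β fun e => X N e ω) atTop
        (𝓝 (Real.log 2 + maxGain supp p c β)) := by
  -- Countably many `t` increasing to `1`, sets `A` and rational points: the exceptional null set
  -- does not depend on `β`.
  have hup : ∀ᵐ ω ∂P, ∀ (m : ℕ) (A : Finset (Fin n)), ∀ᶠ N : ℕ in atTop,
      expSqSum supp (site N) (1 - 1 / ((m : ℝ) + 2)) A (fun e => X N e ω) <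
        (N : ℝ) ^ 2 * 2 ^ ∑ i, ℓ N i :=
    ae_all_iff.2 fun m => ae_all_iff.2 fun A => ae_eventually_expSqSum_lt hs hX
      (sub_lt_self _ (by positivity)) A
  have hlow : ∀ᵐ ω ∂P, ∀ r : J → ℚ, StrictlyFeasible supp p (fun j => (r j : ℝ)) →
      ∀ᶠ N : ℕ in atTop, 2 ^ (∑ i, ℓ N i) * (∏ j, gaussianTail (√N * r j)) / 2 ≤
      ((Finset.univ.filter fun σ : Config (ℓ N) =>
        ∀ j, √N * r j ≤ X N (site N σ j) ω).card : ℝ) := by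
    refine ae_all_iff.2 fun r => ?_
    by_cases hr : StrictlyFeasible supp p (fun j => (r j : ℝ))
    · filter_upwards [ae_eventually_le_card_large hsupp hs hX hlim hr] with ω hω _
      exact hω
    · exact ae_of_all _ fun _ h => absurd h hr
  filter_upwards [hup, hlow] with ω h1 h2 β hβ
  refine tendsto_order.2 ⟨fun b hb => ?_, fun b hb => ?_⟩
  · obtain ⟨_, ⟨x, hx, rfl⟩, hx2⟩ := exists_lt_of_lt_csSup
      (show (gain c β '' {x | Feasible supp p x}).Nonempty from ⟨_, 0, feasible_zero hp, rfl⟩)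
      (show b - Real.log 2 < maxGain supp p c β by linarith)
    obtain ⟨r, hr, hr2⟩ := exists_rat_strictlyFeasible hp hc hβ hx
      (show 0 < gain c β x - (b - Real.log 2) by linarith)
    exact le_logPartition (x := fun N e => X N e ω) hℓ hc hr.1 (h2 r hr) hβ (by linarith)
  · have hm : Tendsto (fun m : ℕ => Real.log 2 + maxGain supp p c β / (1 - 1 / ((m : ℝ) + 2)))
        atTop (𝓝 (Real.log 2 + maxGain supp p c β / (1 - 0))) := by
      refine tendsto_const_nhds.add (tendsto_const_nhds.div (tendsto_const_nhds.sub ?_) (by simp))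
      have := (tendsto_add_atTop_iff_nat (f := fun m : ℕ => 1 / (m : ℝ)) 2).2
        tendsto_one_div_atTop_nhds_zero_nat
      simpa using this
    obtain ⟨m, hm⟩ := (hm.eventually_lt_const (by simpa using hb)).exists
    have h3 : 1 / ((m : ℝ) + 2) < 1 := by
      rw [div_lt_one (by positivity)]
      have : (0 : ℝ) ≤ m := Nat.cast_nonneg m
      linarith
    exact logPartition_le (x := fun N e => X N e ω) hsupp hs hℓ hp hc hlim (by linarith)
      (sub_lt_self _ (by positivity)) (h1 m) hβ hm

end Limit

/-! ### The sequence of critical temperatures and the chain of sets `G_i` -/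

section Chain

variable {n : ℕ} {p : Fin n → ℝ} {a : Subs n → ℝ}

lemma initial_mono (π : Equiv.Perm (Fin n)) {i j : ℕ} (h : i ≤ j) :
    initial π i ⊆ initial π j :=
  Finset.image_subset_image fun m hm => by
    simp only [Finset.mem_filter, Finset.mem_univ, true_and] at hm ⊢
    omega

lemma mem_initial {π : Equiv.Perm (Fin n)} {j : ℕ} {m : Fin n} :
    π m ∈ initial π j ↔ (m : ℕ) < j := by
  simp [initial]

lemma initial_zero (π : Equiv.Perm (Fin n)) : initial π 0 = ∅ := by simp [initial]

lemma initial_self (π : Equiv.Perm (Fin n)) : initial π n = Finset.univ := by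
  apply Finset.eq_univ_of_card
  rw [card_initial π le_rfl, Fintype.card_fin]

lemma sum_initial_sdiff (p : Fin n → ℝ) (π : Equiv.Perm (Fin n)) (i j : ℕ) :
    ∑ m ∈ Finset.univ.filter (fun m : Fin n => i ≤ m.val ∧ m.val < j), p (π m) =
      ∑ m ∈ initial π j \ initial π i, p m := by
  have : initial π j \ initial π i =
      (Finset.univ.filter fun m : Fin n => i ≤ m.val ∧ m.val < j).image π := by
    ext x
    obtain ⟨m, rfl⟩ := π.surjective x
    simp only [Finset.mem_sdiff, mem_initial, Finset.mem_image, Finset.mem_filter,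
      Finset.mem_univ, true_and, EmbeddingLike.apply_eq_iff_eq, exists_eq_right]
    omega
  rw [this, Finset.sum_image π.injective.injOn]

/-- Supermodularity: a set contained in `A` or `B` lies in `A ∪ B`, and one contained in both lies
in `A ∩ B`. Combined with the additivity of `entropyCost`, this drives all the uncrossing arguments
below. -/
lemma wSq_add_le (a : Subs n → ℝ) (A B : Finset (Fin n)) :
    wSq a A + wSq a B ≤ wSq a (A ∪ B) + wSq a (A ∩ B) := by
  classical
  unfold wSq
  rw [← Finset.sum_union_inter, ← Finset.filter_and, ← Finset.filter_or]
  refine add_le_add (Finset.sum_le_sum_of_subset_of_nonneg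
    (Finset.monotone_filter_right _ fun s _ hs => ?_) fun _ _ _ => sq_nonneg _)
    (Finset.sum_le_sum_of_subset_of_nonneg
    (Finset.monotone_filter_right _ fun s _ hs => ?_) fun _ _ _ => sq_nonneg _)
  · exact hs.elim (fun h => h.trans Finset.subset_union_left)
      fun h => h.trans Finset.subset_union_right
  · exact Finset.subset_inter hs.1 hs.2

/-- Removes `∞` and the square root from comparisons with `ratio`. For `v ≤ 0` the quotient is `∞`
because `u > 0`, in agreement with the right side. -/
lemma ofReal_le_sqrt_div {t u v : ℝ} (ht : 0 ≤ t) (hu : 0 < u) :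
    ENNReal.ofReal t ≤ (ENNReal.ofReal u / ENNReal.ofReal v) ^ (1 / 2 : ℝ) ↔ t ^ 2 * v ≤ u := by
  rw [one_div, ENNReal.le_rpow_inv_iff two_pos, ENNReal.rpow_two,
    ENNReal.le_div_iff_mul_le (Or.inr (by simpa using hu)) (Or.inl ENNReal.ofReal_ne_top),
    ← ENNReal.ofReal_pow ht, ← ENNReal.ofReal_mul (sq_nonneg t), ENNReal.ofReal_le_ofReal_iff hu.le]

lemma sqrt_div_le_ofReal {t u v : ℝ} (ht : 0 ≤ t) (hu : 0 < u) :
    (ENNReal.ofReal u / ENNReal.ofReal v) ^ (1 / 2 : ℝ) ≤ ENNReal.ofReal t ↔ u ≤ t ^ 2 * v := by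
  rw [one_div, ENNReal.rpow_inv_le_iff two_pos, ENNReal.rpow_two, ← ENNReal.ofReal_pow ht,
    ENNReal.div_le_iff_le_mul (Or.inr ENNReal.ofReal_ne_top) (Or.inl ENNReal.ofReal_ne_top),
    ← ENNReal.ofReal_mul (sq_nonneg t)]
  constructor
  · intro h
    by_contra h'
    exact absurd ((ENNReal.ofReal_lt_ofReal_iff hu).2 (not_le.1 h')) (not_lt.2 h)
  · exact ENNReal.ofReal_le_ofReal

/-- The numerator of the square of `ratio`. -/
noncomputable def entropyCost (p : Fin n → ℝ) (A : Finset (Fin n)) : ℝ :=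
  2 * (∑ m ∈ A, p m) * Real.log 2

lemma entropyCost_pos (hp : ∀ i, 0 < p i) {A : Finset (Fin n)} (hA : A.Nonempty) :
    0 < entropyCost p A :=
  mul_pos (mul_pos two_pos (Finset.sum_pos (fun i _ => hp i) hA)) (Real.log_pos one_lt_two)

lemma entropyCost_sdiff (p : Fin n → ℝ) {A B : Finset (Fin n)} (h : A ⊆ B) :
    entropyCost p (B \ A) = entropyCost p B - entropyCost p A := by
  rw [entropyCost, Finset.sum_sdiff_eq_sub h, entropyCost, entropyCost]
  ring

lemma entropyCost_union_add_inter (p : Fin n → ℝ) (A B : Finset (Fin n)) :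
    entropyCost p (A ∪ B) + entropyCost p (A ∩ B) = entropyCost p A + entropyCost p B := by
  simp only [entropyCost]
  linear_combination (2 * Real.log 2) * Finset.sum_union_inter (s₁ := A) (s₂ := B) (f := p)

lemma ratio_eq (p : Fin n → ℝ) (a : Subs n → ℝ) (π : Equiv.Perm (Fin n)) (i j : ℕ) :
    ratio p a π i j = (ENNReal.ofReal (entropyCost p (initial π j \ initial π i)) /
      ENNReal.ofReal (wSq a (initial π j) - wSq a (initial π i))) ^ (1 / 2 : ℝ) := by
  rw [ratio, sum_initial_sdiff, entropyCost]

lemma entropyCost_initial_pos (hp : ∀ i, 0 < p i) (π : Equiv.Perm (Fin n)) {i j : ℕ} (hij : i < j)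
    (hj : j ≤ n) : 0 < entropyCost p (initial π j \ initial π i) := by
  refine entropyCost_pos hp (Finset.sdiff_nonempty.2 fun h => ?_)
  have := Finset.card_le_card h
  rw [card_initial π hj, card_initial π (by omega)] at this
  omega

lemma exists_ratio_eq_minRatio {Q : Finset (Equiv.Perm (Fin n))} (hQ : Q.Nonempty) {l : ℕ}
    (hl : l < n) : ∃ π ∈ Q, ∃ j, l < j ∧ j ≤ n ∧ ratio p a π l j = minRatio p a Q l := by
  obtain ⟨π, hπ⟩ := hQ
  have hne : (Q ×ˢ Finset.Ioc l n).Nonempty :=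
    ⟨(π, n), Finset.mem_product.2 ⟨hπ, Finset.mem_Ioc.2 ⟨hl, le_rfl⟩⟩⟩
  obtain ⟨x, hx, hmin⟩ := Finset.exists_min_image _ (fun x => ratio p a x.1 l x.2) hne
  have hx' := Finset.mem_product.1 hx
  have hj := Finset.mem_Ioc.1 hx'.2
  refine ⟨x.1, hx'.1, x.2, hj.1, hj.2, le_antisymm ?_ ?_⟩
  · exact le_iInf₂ fun τ hτ => le_iInf₂ fun j hj => hmin (τ, j) (Finset.mem_product.2 ⟨hτ, hj⟩)
  · exact (iInf₂_le x.1 hx'.1).trans (iInf₂_le x.2 hx'.2)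

lemma minRatio_le {Q : Finset (Equiv.Perm (Fin n))} {π : Equiv.Perm (Fin n)} (hπ : π ∈ Q)
    {l j : ℕ} (hj : l < j) (hj' : j ≤ n) : minRatio p a Q l ≤ ratio p a π l j :=
  (iInf₂_le π hπ).trans (iInf₂_le j (Finset.mem_Ioc.2 ⟨hj, hj'⟩))

lemma minRatio_eq_top {Q : Finset (Equiv.Perm (Fin n))} {l : ℕ} (hl : n ≤ l) :
    minRatio p a Q l = ∞ := by
  simp [minRatio, Finset.Ioc_eq_empty_of_le hl]

/-! ### Minimality and maximality of the sets `G_i` -/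

lemma card_le (A : Finset (Fin n)) : A.card ≤ n := by simpa using Finset.card_le_univ A

/-- Membership in `𝒫_i` depends only on the first `|G_i|` values, which exhaust `G_i`; the remaining
values can be arranged to list `A` next. A minimum over pairs `(π, j)` thereby becomes a minimum
over the sets properly containing `G_i`. -/
lemma exists_mem_stage_initial (p : Fin n → ℝ) (a : Subs n → ℝ) (i : ℕ) {A : Finset (Fin n)}
    (hA : (stage p a i).1 ⊆ A) : ∃ τ ∈ (stage p a i).2, initial τ A.card = A := by
  obtain ⟨⟨π, hπ⟩, h2, h3⟩ := stage_spec p a i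
  obtain ⟨τ, hτ, hτ'⟩ := exists_perm_extend π (h2 π hπ) hA
  exact ⟨τ, h3 π hπ τ hτ, hτ'⟩

lemma initial_subset_nextSet {G : Finset (Fin n)} {Q : Finset (Equiv.Perm (Fin n))}
    {π : Equiv.Perm (Fin n)} (hπ : π ∈ Q) {j : ℕ} (hj : G.card < j) (hj' : j ≤ n)
    (h : ratio p a π G.card j = minRatio p a Q G.card) : initial π j ⊆ nextSet p a G Q := by
  classical
  refine subset_trans ?_ Finset.subset_union_right
  have hx : (π, j) ∈ Q ×ˢ Finset.Ioc G.card n :=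
    Finset.mem_product.2 ⟨hπ, Finset.mem_Ioc.2 ⟨hj, hj'⟩⟩
  exact Finset.subset_biUnion_of_mem (fun x : Equiv.Perm (Fin n) × ℕ => initial x.1 x.2)
    (Finset.mem_filter.2 ⟨hx, h⟩)

lemma sq_mul_le_of_le_critical (hp : ∀ i, 0 < p i) {i : ℕ} {t : ℝ} (ht : 0 ≤ t)
    (h : ENNReal.ofReal t ≤ critical p a (i + 1)) {A : Finset (Fin n)}
    (hA : (stage p a i).1 ⊆ A) :
    t ^ 2 * (wSq a A - wSq a (stage p a i).1) ≤ entropyCost p (A \ (stage p a i).1) := by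
  rcases hA.eq_or_ssubset with h' | h'
  · rw [← h']
    simp [entropyCost]
  · obtain ⟨τ, hτ, hτA⟩ := exists_mem_stage_initial p a i hA
    have h1 := h.trans (minRatio_le hτ (Finset.card_lt_card h') (card_le A))
    rw [ratio_eq, hτA, (stage_spec p a i).2.1 τ hτ] at h1
    exact (ofReal_le_sqrt_div ht (entropyCost_pos hp (Finset.sdiff_nonempty.2 h'.2))).1 h1

lemma subset_stage_succ (hp : ∀ i, 0 < p i) {i : ℕ} {t : ℝ} (ht : 0 ≤ t)
    (h : critical p a (i + 1) = ENNReal.ofReal t) {A : Finset (Fin n)}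
    (hA : (stage p a i).1 ⊆ A)
    (h2 : entropyCost p (A \ (stage p a i).1) ≤ t ^ 2 * (wSq a A - wSq a (stage p a i).1)) :
    A ⊆ (stage p a (i + 1)).1 := by
  classical
  rcases hA.eq_or_ssubset with h' | h'
  · rw [← h']
    exact subset_nextSet p a _ _
  · obtain ⟨τ, hτ, hτA⟩ := exists_mem_stage_initial p a i hA
    have hc := Finset.card_lt_card h'
    have h1 : ratio p a τ (stage p a i).1.card A.card = critical p a (i + 1) := by
      refine le_antisymm ?_ (minRatio_le hτ hc (card_le A))
      rw [h, ratio_eq, hτA, (stage_spec p a i).2.1 τ hτ]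
      exact (sqrt_div_le_ofReal ht (entropyCost_pos hp (Finset.sdiff_nonempty.2 h'.2))).2 h2
    nth_rewrite 1 [← hτA]
    exact initial_subset_nextSet hτ hc (card_le A) h1

/-- A union of minimisers is again a minimiser. With `t = β_{i+1}`, the function `A ↦ entropyCost p
(A \ G_i) - t² (w²_A - w²_{G_i})` is submodular and nonnegative on supersets of `G_i`, so its zeros
are closed under union. -/
lemma entropyCost_stage_succ (hp : ∀ i, 0 < p i) {i : ℕ} {t : ℝ} (ht : 0 ≤ t)
    (h : critical p a (i + 1) = ENNReal.ofReal t) :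
    t ^ 2 * (wSq a (stage p a (i + 1)).1 - wSq a (stage p a i).1) =
      entropyCost p ((stage p a (i + 1)).1 \ (stage p a i).1) := by
  classical
  refine le_antisymm (sq_mul_le_of_le_critical hp ht h.ge (subset_nextSet p a _ _)) ?_
  set G := (stage p a i).1 with hG
  set Q := (stage p a i).2 with hQ
  -- Induction over finite families of minimisers; the old union `U` and the new set `A` are
  -- uncrossed using the lower bound at `U ∩ A`.
  have key : ∀ F : Finset (Equiv.Perm (Fin n) × ℕ),
      F ⊆ (Q ×ˢ Finset.Ioc G.card n).filter
        (fun x => ratio p a x.1 G.card x.2 = minRatio p a Q G.card) →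
      entropyCost p ((G ∪ F.biUnion fun x => initial x.1 x.2) \ G) ≤
        t ^ 2 * (wSq a (G ∪ F.biUnion fun x => initial x.1 x.2) - wSq a G) := by
    intro F
    induction F using Finset.induction_on with
    | empty => intro _; simp [entropyCost]
    | insert x F hx ih =>
      intro hF
      have ih := ih fun y hy => hF (Finset.mem_insert_of_mem hy)
      obtain ⟨hx1, hx2⟩ := Finset.mem_filter.1 (hF (Finset.mem_insert_self x F))
      obtain ⟨hx3, hx4⟩ := Finset.mem_product.1 hx1
      obtain ⟨hx5, hx6⟩ := Finset.mem_Ioc.1 hx4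
      have hin := (stage_spec p a i).2.1 x.1 hx3
      rw [← hG] at hin
      have hGA : G ⊆ initial x.1 x.2 := by
        nth_rewrite 1 [← hin]
        exact initial_mono _ hx5.le
      have hxr : ratio p a x.1 G.card x.2 ≤ ENNReal.ofReal t := by
        rw [hx2, ← h]
        exact le_rfl
      rw [ratio_eq, sqrt_div_le_ofReal ht (entropyCost_initial_pos hp _ hx5 hx6), hin] at hxr
      set U := G ∪ F.biUnion fun x => initial x.1 x.2 with hU
      set A := initial x.1 x.2 with hA
      have hUA : G ∪ (insert x F).biUnion (fun x => initial x.1 x.2) = U ∪ A := by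
        rw [Finset.biUnion_insert, hU, hA, Finset.union_assoc,
          Finset.union_comm (initial x.1 x.2)]
      have hGU : G ⊆ U := Finset.subset_union_left
      have hI := sq_mul_le_of_le_critical hp ht h.ge (A := U ∩ A) (Finset.subset_inter hGU hGA)
      rw [← hG] at hI
      rw [hUA]
      rw [entropyCost_sdiff p hGU] at ih
      rw [entropyCost_sdiff p hGA] at hxr
      rw [entropyCost_sdiff p (Finset.subset_inter hGU hGA)] at hI
      rw [entropyCost_sdiff p (hGU.trans Finset.subset_union_left)]
      have h1 := entropyCost_union_add_inter p U A
      have h2 := mul_le_mul_of_nonneg_left (wSq_add_le a U A) (sq_nonneg t)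
      linarith
  exact key _ (subset_refl _)

lemma critical_succ_pos (hp : ∀ i, 0 < p i) (i : ℕ) : 0 < critical p a (i + 1) := by
  rw [critical]
  rcases lt_or_ge (stage p a i).1.card n with h | h
  · obtain ⟨π, -, j, h1, h2, h3⟩ := exists_ratio_eq_minRatio (p := p) (a := a)
      (stage_spec p a i).1 h
    have hu := entropyCost_initial_pos hp π h1 h2
    rw [← h3, ratio_eq, pos_iff_ne_zero]
    intro h0
    have := (sqrt_div_le_ofReal le_rfl hu).1 (h0.trans_le zero_le)
    linarith
  · rw [minRatio_eq_top h]
    exact ENNReal.coe_lt_top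

/-- An infinite minimum is attained at `j = n` too, so the next set is everything. -/
lemma stage_succ_of_critical_eq_top {i : ℕ} (h : critical p a (i + 1) = ∞) :
    (stage p a (i + 1)).1.card = n := by
  classical
  refine le_antisymm (card_le _) ?_
  rcases lt_or_ge (stage p a i).1.card n with h1 | h1
  · obtain ⟨π, hπ⟩ := (stage_spec p a i).1
    have h2 : ratio p a π (stage p a i).1.card n = minRatio p a (stage p a i).2
        (stage p a i).1.card :=
      le_antisymm (le_top.trans_eq h.symm) (minRatio_le hπ h1 le_rfl)
    have hsub : initial π n ⊆ (stage p a (i + 1)).1 :=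
      initial_subset_nextSet hπ h1 le_rfl h2
    have := Finset.card_le_card hsub
    rwa [card_initial π le_rfl] at this
  · exact h1.trans (Finset.card_le_card (subset_nextSet p a _ _))

lemma critical_eq_top_succ {i : ℕ} (h : critical p a (i + 1) = ∞) :
    critical p a (i + 2) = ∞ :=
  minRatio_eq_top (stage_succ_of_critical_eq_top h).ge

/-- If the next minimum were no larger, its minimiser, combined with the equality for `G_{i+1}`,
would also attain `β_{i+1}` relative to `G_i`. It would then lie inside `G_{i+1}`, although it is
strictly larger. -/
lemma critical_lt_succ (hp : ∀ i, 0 < p i) {i : ℕ} (h : critical p a (i + 1) ≠ ∞) :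
    critical p a (i + 1) < critical p a (i + 2) := by
  rcases lt_or_ge (stage p a (i + 1)).1.card n with h1 | h1
  swap
  · rw [show critical p a (i + 2) = ∞ from minRatio_eq_top h1]
    exact h.lt_top
  obtain ⟨t, ht, hct⟩ : ∃ t : ℝ, 0 ≤ t ∧ critical p a (i + 1) = ENNReal.ofReal t :=
    ⟨_, ENNReal.toReal_nonneg, (ENNReal.ofReal_toReal h).symm⟩
  by_contra! hle
  rw [hct] at hle
  obtain ⟨π, hπ, j, hj1, hj2, hj3⟩ := exists_ratio_eq_minRatio (p := p) (a := a)
      (stage_spec p a (i + 1)).1 h1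
  have hr : ratio p a π (stage p a (i + 1)).1.card j ≤ ENNReal.ofReal t := hj3.trans_le hle
  have hin := (stage_spec p a (i + 1)).2.1 π hπ
  rw [ratio_eq, sqrt_div_le_ofReal ht (entropyCost_initial_pos hp _ hj1 hj2), hin] at hr
  have hsub : (stage p a (i + 1)).1 ⊆ initial π j := by
    rw [← hin]
    exact initial_mono _ hj1.le
  have hsub' : (stage p a i).1 ⊆ (stage p a (i + 1)).1 := subset_nextSet p a _ _
  have h3 := entropyCost_stage_succ hp ht hct
  have h4 := subset_stage_succ hp ht hct (hsub'.trans hsub) (by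
    rw [entropyCost_sdiff p (hsub'.trans hsub)]
    rw [entropyCost_sdiff p hsub] at hr
    rw [entropyCost_sdiff p hsub'] at h3
    linarith)
  have := Finset.card_le_card h4
  rw [card_initial π hj2] at this
  omega

lemma critical_mono (hp : ∀ i, 0 < p i) : Monotone (critical p a) := by
  refine monotone_nat_of_le_succ fun i => ?_
  cases i with
  | zero => exact zero_le
  | succ i =>
    by_cases h : critical p a (i + 1) = ∞
    · rw [critical_eq_top_succ h]
      exact le_top
    · exact (critical_lt_succ hp h).le

/-- The properties of the chain `G_i` and of the truncated critical temperatures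
`min β β_{i+1}` that determine the solution of the variational problem. -/
structure IsCriticalChain (p : Fin n → ℝ) (a : Subs n → ℝ) (β : ℝ) (G : ℕ → Finset (Fin n))
    (θ : ℕ → ℝ) : Prop where
  zero : G 0 = ∅
  mono : Monotone G
  pos : ∀ i, 0 < θ i
  le : ∀ i, θ i ≤ β
  lt_succ : ∀ i, θ i < β → θ i < θ (i + 1)
  monotone : Monotone θ
  sq_mul_le : ∀ i A, G i ⊆ A → θ i ^ 2 * (wSq a A - wSq a (G i)) ≤ entropyCost p (A \ G i)
  sq_mul_eq : ∀ i, θ i < β →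
    θ i ^ 2 * (wSq a (G (i + 1)) - wSq a (G i)) = entropyCost p (G (i + 1) \ G i)

/-- The truncation of `β_{i+1}` at `β`. -/
noncomputable def truncCritical (p : Fin n → ℝ) (a : Subs n → ℝ) (β : ℝ) (i : ℕ) : ℝ :=
  (min (critical p a (i + 1)) (ENNReal.ofReal β)).toReal

lemma isCriticalChain_stage (hp : ∀ i, 0 < p i) (a : Subs n → ℝ) {β : ℝ} (hβ : 0 < β) :
    IsCriticalChain p a β (fun i => (stage p a i).1) (truncCritical p a β) := by
  have hne : ∀ i, min (critical p a (i + 1)) (ENNReal.ofReal β) ≠ ∞ := fun i =>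
    ne_top_of_le_ne_top ENNReal.ofReal_ne_top (min_le_right _ _)
  have hof : ∀ i, ENNReal.ofReal (truncCritical p a β i) =
      min (critical p a (i + 1)) (ENNReal.ofReal β) := fun i => ENNReal.ofReal_toReal (hne i)
  have hnn : ∀ i, 0 ≤ truncCritical p a β i := fun i => ENNReal.toReal_nonneg
  -- Below `β` the truncation is inactive, so the exact identities for finite critical values apply.
  have hlt : ∀ i, truncCritical p a β i < β →
      critical p a (i + 1) = ENNReal.ofReal (truncCritical p a β i) := by
    intro i hi
    rw [hof]
    rcases min_cases (critical p a (i + 1)) (ENNReal.ofReal β) with h | h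
    · exact h.1.symm
    · rw [truncCritical, h.1, ENNReal.toReal_ofReal hβ.le] at hi
      exact absurd hi (lt_irrefl _)
  refine ⟨rfl, monotone_nat_of_le_succ fun i => subset_nextSet p a _ _, fun i => ?_, fun i => ?_,
    fun i hi => ?_, fun i j hij => ?_, fun i A hA => ?_, fun i hi => ?_⟩
  · exact ENNReal.toReal_pos
      (lt_min (critical_succ_pos hp i) (ENNReal.ofReal_pos.2 hβ)).ne' (hne i)
  · refine ENNReal.toReal_le_of_le_ofReal hβ.le (min_le_right _ _)
  · refine (ENNReal.toReal_lt_toReal (hne i) (hne (i + 1))).2 ?_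
    have h1 := hlt i hi
    rw [← hof i, ← h1]
    refine lt_min (critical_lt_succ hp (by rw [h1]; exact ENNReal.ofReal_ne_top)) ?_
    rw [h1]
    exact (ENNReal.ofReal_lt_ofReal_iff hβ).2 hi
  · exact ENNReal.toReal_mono (hne j) (min_le_min_right _ (critical_mono hp (by omega)))
  · exact sq_mul_le_of_le_critical hp (hnn i) ((hof i).trans_le (min_le_left _ _)) hA
  · exact entropyCost_stage_succ hp (hnn i) (hlt i hi)

lemma truncCritical_lt {β : ℝ} (hp : ∀ i, 0 < p i) (hβ : 0 < β) {i k : ℕ}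
    (h : critical p a k < ENNReal.ofReal β) (hi : i < k) : truncCritical p a β i < β := by
  have h1 := ((critical_mono (p := p) (a := a) hp (by omega : i + 1 ≤ k)).trans_lt h)
  rw [truncCritical, min_eq_left h1.le]
  have := (ENNReal.toReal_lt_toReal (h1.trans ENNReal.ofReal_lt_top).ne ENNReal.ofReal_ne_top).2 h1
  rwa [ENNReal.toReal_ofReal hβ.le] at this

lemma mem_stage_iff {π : Equiv.Perm (Fin n)} {i : ℕ} :
    π ∈ (stage p a i).2 ↔ ∀ m ≤ i, initial π (stage p a m).1.card = (stage p a m).1 := by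
  induction i with
  | zero => simp [stage, initial_zero]
  | succ i ih =>
    rw [show (stage p a (i + 1)).2 = (stage p a i).2.filter
      fun π => initial π (stage p a (i + 1)).1.card = (stage p a (i + 1)).1 from rfl,
      Finset.mem_filter, ih]
    constructor
    · rintro ⟨h1, h2⟩ m hm
      rcases Nat.le_succ_iff.1 hm with h | rfl
      · exact h1 m h
      · exact h2
    · intro h
      exact ⟨fun m hm => h m (by omega), h _ le_rfl⟩

lemma stage_numStages (p : Fin n → ℝ) (a : Subs n → ℝ) :
    (stage p a (numStages p a)).1 = Finset.univ :=
  Nat.find_spec (exists_stage_eq_univ p a)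

lemma critical_ne_top_of_lt {i : ℕ} (hi : i < numStages p a) : critical p a i ≠ ∞ := by
  cases i with
  | zero => exact ENNReal.zero_ne_top
  | succ i =>
    intro h
    refine Nat.find_min (exists_stage_eq_univ p a) hi (Finset.eq_univ_of_card _ ?_)
    rw [stage_succ_of_critical_eq_top h, Fintype.card_fin]

end Chain

/-! ### Sums over the subsets of the sets `{π(1), …, π(j)}` -/

section Sums

variable {n : ℕ} {p : Fin n → ℝ} {a : Subs n → ℝ} {β : ℝ} {π : Equiv.Perm (Fin n)}

lemma sum_subset_split (g : Subs n → ℝ) {A B : Finset (Fin n)} (h : A ⊆ B) :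
    ∑ s with s.1 ⊆ B, g s = ∑ s with s.1 ⊆ A, g s + ∑ s with s.1 ⊆ B ∧ ¬ s.1 ⊆ A, g s := by
  classical
  rw [← Finset.sum_filter_add_sum_filter_not (Finset.univ.filter fun s : Subs n => s.1 ⊆ B)
    (fun s => s.1 ⊆ A), Finset.filter_filter, Finset.filter_filter]
  congr 2
  ext s
  simp only [Finset.mem_filter, Finset.mem_univ, true_and, and_iff_right_iff_imp]
  exact fun hs => hs.trans h

lemma sum_subset_empty (g : Subs n → ℝ) : ∑ s with s.1 ⊆ ∅, g s = 0 := by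
  refine Finset.sum_eq_zero fun s hs => ?_
  exact absurd (Finset.subset_empty.1 (Finset.mem_filter.1 hs).2) s.2.ne_empty

lemma sum_subset_univ (g : Subs n → ℝ) : ∑ s with s.1 ⊆ Finset.univ, g s = ∑ s, g s := by
  simp

lemma sum_fin_lt (f : ℕ → ℝ) {j : ℕ} (hj : j ≤ n) :
    ∑ m with (m : Fin n).val < j, f m = ∑ m ∈ Finset.range j, f m := by
  rw [Finset.sum_filter, Fin.sum_univ_eq_sum_range (fun m => if m < j then f m else 0),
    ← Finset.sum_filter]
  congr 1
  ext m
  simp only [Finset.mem_filter, Finset.mem_range]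
  omega

/-- The sum over the subsets of `{π(1), …, π(j)}`, grouped by the level at which they appear. -/
lemma sum_levels (g : Subs n → ℝ) (π : Equiv.Perm (Fin n)) {j : ℕ} (hj : j ≤ n) :
    ∑ m with (m : Fin n).val < j,
      ∑ s with s.1 ⊆ initial π ((m : ℕ) + 1) ∧ ¬ s.1 ⊆ initial π m, g s =
      ∑ s with s.1 ⊆ initial π j, g s := by
  have h : ∀ m : ℕ, ∑ s with s.1 ⊆ initial π (m + 1) ∧ ¬ s.1 ⊆ initial π m, g s =
      ∑ s with s.1 ⊆ initial π (m + 1), g s - ∑ s with s.1 ⊆ initial π m, g s := fun m => by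
    rw [sum_subset_split g (initial_mono π (Nat.le_succ m))]
    ring
  simp_rw [h]
  rw [sum_fin_lt (fun m => ∑ s with s.1 ⊆ initial π (m + 1), g s -
    ∑ s with s.1 ⊆ initial π m, g s) hj,
    Finset.sum_range_sub fun m => ∑ s with s.1 ⊆ initial π m, g s]
  rw [initial_zero, sum_subset_empty, sub_zero]

lemma sum_fin_lt_self (f : Fin n → ℝ) : ∑ m with (m : Fin n).val < n, f m = ∑ m, f m := by
  simp

lemma sum_levels_univ (g : Subs n → ℝ) (π : Equiv.Perm (Fin n)) :
    ∑ m : Fin n, ∑ s with s.1 ⊆ initial π ((m : ℕ) + 1) ∧ ¬ s.1 ⊆ initial π m, g s =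
      ∑ s, g s := by
  have h := sum_levels g π le_rfl
  rwa [initial_self, sum_subset_univ, sum_fin_lt_self] at h

lemma sq_levelWeight (a : Subs n → ℝ) (π : Equiv.Perm (Fin n)) (i : Fin n) :
    levelWeight a π i ^ 2 =
      ∑ s with s.1 ⊆ initial π ((i : ℕ) + 1) ∧ ¬ s.1 ⊆ initial π i, a s ^ 2 :=
  Real.sq_sqrt (Finset.sum_nonneg fun _ _ => sq_nonneg _)

lemma levelWeight_nonneg (a : Subs n → ℝ) (π : Equiv.Perm (Fin n)) (i : Fin n) :
    0 ≤ levelWeight a π i := Real.sqrt_nonneg _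

lemma sum_sq_levelWeight (a : Subs n → ℝ) (π : Equiv.Perm (Fin n)) {j : ℕ} (hj : j ≤ n) :
    ∑ m with (m : Fin n).val < j, levelWeight a π m ^ 2 = wSq a (initial π j) := by
  simp_rw [sq_levelWeight]
  exact sum_levels _ π hj

lemma entropyCost_initial (p : Fin n → ℝ) (π : Equiv.Perm (Fin n)) (j : ℕ) :
    entropyCost p (initial π j) = 2 * (∑ m with (m : Fin n).val < j, p (π m)) * Real.log 2 := by
  rw [entropyCost, initial, Finset.sum_image π.injective.injOn]

lemma entropyCost_mono (hp : ∀ i, 0 < p i) {A B : Finset (Fin n)} (h : A ⊆ B) :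
    entropyCost p A ≤ entropyCost p B := by
  have := Finset.sum_le_sum_of_subset_of_nonneg h (f := p) fun i _ _ => (hp i).le
  have := Real.log_nonneg one_le_two
  rw [entropyCost, entropyCost]
  gcongr

lemma feasible_iff {J : Type*} [Fintype J] {supp : J → Finset (Fin n)} {x : J → ℝ} :
    Feasible supp p x ↔
      (∀ j, 0 ≤ x j) ∧ ∀ A, ∑ j with supp j ⊆ A, x j ^ 2 ≤ entropyCost p A := by
  refine and_congr_right fun _ => forall_congr' fun A => ?_
  rw [← Finset.sum_div, entropyCost, div_le_iff₀ two_pos]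
  ring_nf

/-! ### Comparison of the two variational problems -/

/-- The constraints on the energies of the Bolthausen-Kistler model that survive in the tree
model of the permutation `π`. -/
def ChainFeasible (p : Fin n → ℝ) (π : Equiv.Perm (Fin n)) (x : Subs n → ℝ) : Prop :=
  (∀ s, 0 ≤ x s) ∧
    ∀ j ≤ n, ∑ s with s.1 ⊆ initial π j, x s ^ 2 ≤ entropyCost p (initial π j)

lemma Feasible.chainFeasible {x : Subs n → ℝ} (h : Feasible Subtype.val p x)
    (π : Equiv.Perm (Fin n)) : ChainFeasible p π x :=
  ⟨h.1, fun j _ => (feasible_iff.1 h).2 (initial π j)⟩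

lemma Iic_subset_filter_lt {i : Fin n} {j : ℕ} :
    Finset.Iic i ⊆ Finset.univ.filter (fun m : Fin n => (m : ℕ) < j) ↔ (i : ℕ) < j := by
  constructor
  · intro h
    simpa using h (Finset.mem_Iic.2 le_rfl)
  · intro h m hm
    have : m.val ≤ i.val := (Finset.mem_Iic (a := i)).1 hm
    simp only [Finset.mem_filter, Finset.mem_univ, true_and]
    omega

/-- Supports are initial segments, so `A` may be replaced by the longest initial segment inside it:
the same levels contribute, and the entropy does not increase. -/
lemma tree_feasible_iff (hp : ∀ i, 0 < p i) {y : Fin n → ℝ} :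
    Feasible (fun i : Fin n => Finset.Iic i) (fun i => p (π i)) y ↔ (∀ i, 0 ≤ y i) ∧
      ∀ j ≤ n, ∑ m with (m : Fin n).val < j, y m ^ 2 ≤ entropyCost p (initial π j) := by
  rw [feasible_iff]
  refine and_congr_right fun _ => ⟨fun h j _ => ?_, fun h A => ?_⟩
  · have := h (Finset.univ.filter fun m : Fin n => (m : ℕ) < j)
    simp_rw [Iic_subset_filter_lt] at this
    rwa [entropyCost_initial]
  · rcases (Finset.univ.filter fun i : Fin n => Finset.Iic i ⊆ A).eq_empty_or_nonempty with h0 | h0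
    · rw [h0, Finset.sum_empty]
      exact mul_nonneg (mul_nonneg two_pos.le (Finset.sum_nonneg fun i _ => (hp _).le))
        (Real.log_nonneg one_le_two)
    · obtain ⟨d, hd, hmax⟩ := Finset.exists_max_image _ id h0
      have hdA := (Finset.mem_filter.1 hd).2
      have hD : (Finset.univ.filter fun i : Fin n => Finset.Iic i ⊆ A) =
          Finset.univ.filter fun m : Fin n => (m : ℕ) < (d : ℕ) + 1 := by
        ext i
        simp only [Finset.mem_filter, Finset.mem_univ, true_and, Nat.lt_succ_iff]
        refine ⟨fun hi => hmax i (by simpa using hi), fun hi => ?_⟩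
        exact (Finset.Iic_subset_Iic.2 (show i ≤ d from hi)).trans hdA
      have hsub : (Finset.univ.filter fun m : Fin n => (m : ℕ) < (d : ℕ) + 1) ⊆ A := by
        intro m hm
        apply hdA
        simp only [Finset.mem_filter, Finset.mem_univ, true_and, Nat.lt_succ_iff] at hm
        exact Finset.mem_Iic.2 (show m ≤ d from hm)
      rw [hD]
      refine (h _ d.2).trans ?_
      rw [entropyCost_initial]
      exact entropyCost_mono (p := fun i => p (π i)) (fun i => hp _) hsub

/-- Energies of sets new at the same level are merged into their Euclidean norm. Quadratic terms are
preserved, and linear terms can only grow by Cauchy–Schwarz, as `levelWeight` is the norm of the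
corresponding `a_s`. -/
lemma exists_tree_feasible (hp : ∀ i, 0 < p i) (hβ : 0 < β)
    {x : Subs n → ℝ} (hx : ChainFeasible p π x) :
    ∃ y, Feasible (fun i : Fin n => Finset.Iic i) (fun i => p (π i)) y ∧
      gain a β x ≤ gain (levelWeight a π) β y := by
  let y : Fin n → ℝ := fun m =>
    √(∑ s with s.1 ⊆ initial π ((m : ℕ) + 1) ∧ ¬ s.1 ⊆ initial π m, x s ^ 2)
  have hy : ∀ m, y m ^ 2 =
      ∑ s with s.1 ⊆ initial π ((m : ℕ) + 1) ∧ ¬ s.1 ⊆ initial π m, x s ^ 2 := fun m =>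
    Real.sq_sqrt (Finset.sum_nonneg fun _ _ => sq_nonneg _)
  refine ⟨y, (tree_feasible_iff hp).2 ⟨fun m => Real.sqrt_nonneg _, fun j hj => ?_⟩, ?_⟩
  · simp_rw [hy]
    rw [sum_levels _ π hj]
    exact hx.2 j hj
  · rw [gain, ← sum_levels_univ _ π, gain]
    refine Finset.sum_le_sum fun m _ => ?_
    rw [Finset.sum_sub_distrib, hy, Finset.sum_div]
    refine sub_le_sub_right ?_ _
    simp_rw [mul_assoc β]
    rw [← Finset.mul_sum]
    exact mul_le_mul_of_nonneg_left (Real.sum_mul_le_sqrt_mul_sqrt _ a x) hβ.le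

/-! ### The optimal energies -/

/-- The index `i` of the first set `G_{i+1}` of the chain that contains `s`. -/
noncomputable def chainLevel (G : ℕ → Finset (Fin n)) (s : Subs n) : ℕ :=
  sInf {i | s.1 ⊆ G (i + 1)}

/-- The optimal energies: `min β β_{i+1}` times `a_s` if `s` first appears in `G_{i+1}`. -/
noncomputable def optEnergy (a : Subs n → ℝ) (G : ℕ → Finset (Fin n)) (θ : ℕ → ℝ) (s : Subs n) :
    ℝ :=
  θ (chainLevel G s) * a s

variable {G : ℕ → Finset (Fin n)} {θ : ℕ → ℝ}

lemma chainLevel_eq (hG : Monotone G) {s : Subs n} {i : ℕ} (h : s.1 ⊆ G (i + 1))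
    (h' : ¬ s.1 ⊆ G i) : chainLevel G s = i := by
  refine le_antisymm (Nat.sInf_le h) ?_
  by_contra! hlt
  have h1 : s.1 ⊆ G (chainLevel G s + 1) := Nat.sInf_mem (s := {i | s.1 ⊆ G (i + 1)}) ⟨i, h⟩
  exact h' (h1.trans (hG hlt))

lemma lt_chainLevel (hG : Monotone G) {K : ℕ} (hK : G K = Finset.univ) {s : Subs n} {i : ℕ}
    (h : ¬ s.1 ⊆ G (i + 1)) : i < chainLevel G s := by
  by_contra! hle
  have h1 : s.1 ⊆ G (chainLevel G s + 1) := Nat.sInf_mem (s := {i | s.1 ⊆ G (i + 1)})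
    ⟨K, by
      have h2 : G K ⊆ G (K + 1) := hG (Nat.le_succ K)
      rw [hK] at h2
      exact (Finset.subset_univ _).trans h2⟩
  exact h (h1.trans (hG (Nat.succ_le_succ hle)))

/-- Going from `A ∩ G_i` to `A ∩ G_{i+1}` adds only sets with energy `θ_i a_s`. By supermodularity
their `w²` is at most what `A ∩ G_{i+1}` adds on top of `G_i`, and minimality of the critical value
bounds this by the same increase of entropy. -/
lemma sum_sq_optEnergy_le (h : IsCriticalChain p a β G θ) (A : Finset (Fin n)) (i : ℕ) :
    ∑ s with s.1 ⊆ A ∩ G i, optEnergy a G θ s ^ 2 ≤ entropyCost p (A ∩ G i) := by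
  induction i with
  | zero =>
    rw [h.zero, Finset.inter_empty, sum_subset_empty]
    simp [entropyCost]
  | succ i ih =>
    have hsub : A ∩ G i ⊆ A ∩ G (i + 1) := Finset.inter_subset_inter_left (h.mono (Nat.le_succ i))
    rw [sum_subset_split _ hsub]
    have h1 : ∑ s with s.1 ⊆ A ∩ G (i + 1) ∧ ¬ s.1 ⊆ A ∩ G i, optEnergy a G θ s ^ 2 =
        θ i ^ 2 * ∑ s with s.1 ⊆ A ∩ G (i + 1) ∧ ¬ s.1 ⊆ A ∩ G i, a s ^ 2 := by
      rw [Finset.mul_sum]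
      refine Finset.sum_congr rfl fun s hs => ?_
      obtain ⟨hs1, hs2⟩ := (Finset.mem_filter.1 hs).2
      obtain ⟨hsA, hsG⟩ := Finset.subset_inter_iff.1 hs1
      rw [optEnergy, chainLevel_eq h.mono hsG fun h' => hs2 (Finset.subset_inter hsA h'), mul_pow]
    have h2 := h.sq_mul_le i (A ∩ G (i + 1) ∪ G i) Finset.subset_union_right
    have h3 : ∑ s with s.1 ⊆ A ∩ G (i + 1) ∧ ¬ s.1 ⊆ A ∩ G i, a s ^ 2 ≤
        wSq a (A ∩ G (i + 1) ∪ G i) - wSq a (G i) := by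
      have h4 := wSq_add_le a (A ∩ G (i + 1)) (G i)
      have h5 : A ∩ G (i + 1) ∩ G i = A ∩ G i := by
        rw [Finset.inter_assoc, Finset.inter_eq_right.2 (h.mono (Nat.le_succ i))]
      have h6 := sum_subset_split (fun s => a s ^ 2) hsub
      rw [h5] at h4
      simp only [wSq] at h4 ⊢
      linarith
    have h7 : (A ∩ G (i + 1) ∪ G i) \ G i = (A ∩ G (i + 1)) \ (A ∩ G i) := by
      ext m
      simp only [Finset.mem_sdiff, Finset.mem_union, Finset.mem_inter]
      tauto
    rw [h7, entropyCost_sdiff p hsub] at h2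
    rw [h1]
    have := mul_le_mul_of_nonneg_left h3 (sq_nonneg (θ i))
    linarith

lemma feasible_optEnergy (h : IsCriticalChain p a β G θ) (ha : ∀ s, 0 ≤ a s) {K : ℕ}
    (hK : G K = Finset.univ) : Feasible Subtype.val p (optEnergy a G θ) := by
  refine feasible_iff.2 ⟨fun s => mul_nonneg (h.pos _).le (ha s), fun A => ?_⟩
  simpa [hK] using sum_sq_optEnergy_le h A K

/-- The optimal energies solve the variational problem of the tree model of `π`, if `π` is
compatible with the chain. -/
lemma tree_gain_le (h : IsCriticalChain p a β G θ) (hp : ∀ i, 0 < p i) {K : ℕ}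
    (hK : G K = Finset.univ) (hπ : ∀ i ≤ K, initial π (G i).card = G i) {y : Fin n → ℝ}
    (hy : Feasible (fun i : Fin n => Finset.Iic i) (fun i => p (π i)) y) :
    gain (levelWeight a π) β y ≤ gain a β (optEnergy a G θ) := by
  have hy' := ((tree_feasible_iff hp).1 hy).2
  have hD : ∀ i ≤ K, ∑ m with (m : Fin n).val < (G i).card, y m ^ 2 ≤ entropyCost p (G i) := by
    intro i hi
    have := hy' (G i).card (card_le _)
    rwa [hπ i hi] at this
  have hcoef : ∀ i, 0 ≤ β / θ i - 1 := fun i => by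
    rw [sub_nonneg, one_le_div (h.pos i)]
    exact h.le i
  have hsplit : ∀ (f : Fin n → ℝ) (i : ℕ), ∑ m with (m : Fin n).val < (G (i + 1)).card, f m =
      ∑ m with (m : Fin n).val < (G i).card, f m +
        ∑ m with (G i).card ≤ (m : Fin n).val ∧ m.val < (G (i + 1)).card, f m := by
    intro f i
    have hc : (G i).card ≤ (G (i + 1)).card := Finset.card_le_card (h.mono (Nat.le_succ i))
    rw [← Finset.sum_filter_add_sum_filter_not
      (Finset.univ.filter fun m : Fin n => (m : ℕ) < (G (i + 1)).card)
      (fun m => (m : ℕ) < (G i).card), Finset.filter_filter, Finset.filter_filter]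
    congr 2
    · ext m
      simp only [Finset.mem_filter, Finset.mem_univ, true_and]
      omega
    · ext m
      simp only [Finset.mem_filter, Finset.mem_univ, true_and]
      omega
  -- Weak duality by induction along the chain: the slack at `G_i` is carried with coefficient `β /
  -- θ_i - 1`, which is nonincreasing in `i`. Each passage to the next coefficient therefore
  -- discards a nonnegative amount.
  have key : ∀ i ≤ K,
      ∑ m with (m : Fin n).val < (G i).card, (β * levelWeight a π m * y m - y m ^ 2 / 2) +
        (β / θ i - 1) * ((entropyCost p (G i) -
          ∑ m with (m : Fin n).val < (G i).card, y m ^ 2) / 2) ≤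
      ∑ s with s.1 ⊆ G i, (β * a s * optEnergy a G θ s - optEnergy a G θ s ^ 2 / 2) := by
    intro i
    induction i with
    | zero =>
      intro _
      rw [h.zero, sum_subset_empty]
      simp [entropyCost]
    | succ i ih =>
      intro hi
      have ih := ih (by omega)
      have hθ := h.pos i
      have hsub := h.mono (Nat.le_succ i)
      set W := wSq a (G (i + 1)) - wSq a (G i) with hW
      have hR : ∑ s with s.1 ⊆ G (i + 1) ∧ ¬ s.1 ⊆ G i,
          (β * a s * optEnergy a G θ s - optEnergy a G θ s ^ 2 / 2) =
          (β * θ i - θ i ^ 2 / 2) * W := by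
        have h1 := sum_subset_split (fun s => a s ^ 2) hsub
        have h2 : W = ∑ s with s.1 ⊆ G (i + 1) ∧ ¬ s.1 ⊆ G i, a s ^ 2 := by
          simp only [hW, wSq]
          simp only [Nat.succ_eq_add_one] at h1
          linarith
        rw [h2, Finset.mul_sum]
        refine Finset.sum_congr rfl fun s hs => ?_
        obtain ⟨hs1, hs2⟩ := (Finset.mem_filter.1 hs).2
        rw [optEnergy, chainLevel_eq h.mono hs1 hs2]
        ring
      -- From `2 (θ w) y ≤ (θ w)² + y²`, multiplied by `β / (2 θ)`; equality would mean `y = θ w`.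
      have hL : ∑ m with (G i).card ≤ (m : Fin n).val ∧ m.val < (G (i + 1)).card,
          (β * levelWeight a π m * y m - y m ^ 2 / 2) ≤ β * θ i / 2 * W + (β / θ i - 1) / 2 *
          ∑ m with (G i).card ≤ (m : Fin n).val ∧ m.val < (G (i + 1)).card, y m ^ 2 := by
        have h1 := hsplit (fun m => levelWeight a π m ^ 2) i
        rw [sum_sq_levelWeight a π (card_le _), sum_sq_levelWeight a π (card_le _), hπ _ hi,
          hπ i (by omega)] at h1
        have h2 : W = ∑ m with (G i).card ≤ (m : Fin n).val ∧ m.val < (G (i + 1)).card,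
            levelWeight a π m ^ 2 := by
          rw [hW]
          linarith
        rw [h2, Finset.mul_sum, Finset.mul_sum, ← Finset.sum_add_distrib]
        refine Finset.sum_le_sum fun m _ => ?_
        have hβθ : 0 ≤ β / θ i := div_nonneg (h.pos i |>.le.trans (h.le i)) hθ.le
        have h3 : β = β / θ i * θ i := by field_simp
        have h4 := mul_nonneg hβθ (sq_nonneg (θ i * levelWeight a π m - y m))
        have h5 : β * levelWeight a π m * y m = β / θ i * (θ i * levelWeight a π m * y m) := by
          nth_rewrite 1 [h3]
          ring
        have h6 : β * θ i / 2 * levelWeight a π m ^ 2 =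
            β / θ i * (θ i * levelWeight a π m) ^ 2 / 2 := by
          nth_rewrite 1 [h3]
          ring
        rw [h5, h6]
        nlinarith only [h4]
      -- Complementary slackness: either `θ_i = β` and both sides vanish, or the entropy of the step
      -- is used up exactly.
      have hE : (β / θ i - 1) * (entropyCost p (G (i + 1)) - entropyCost p (G i)) =
          (β * θ i - θ i ^ 2) * W := by
        rcases (h.le i).eq_or_lt with h1 | h1
        · rw [h1, div_self (h1 ▸ hθ).ne']
          ring
        · rw [← entropyCost_sdiff p hsub, ← h.sq_mul_eq i h1, ← hW]
          field_simp
      have hstep : (β / θ (i + 1) - 1) * ((entropyCost p (G (i + 1)) -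
          ∑ m with (m : Fin n).val < (G (i + 1)).card, y m ^ 2) / 2) ≤
          (β / θ i - 1) * ((entropyCost p (G (i + 1)) -
          ∑ m with (m : Fin n).val < (G (i + 1)).card, y m ^ 2) / 2) := by
        refine mul_le_mul_of_nonneg_right (sub_le_sub_right ?_ 1) (by linarith [hD _ hi])
        exact div_le_div_of_nonneg_left (hθ.le.trans (h.le i)) hθ (h.monotone (Nat.le_succ i))
      refine (add_le_add_right hstep _).trans ?_
      rw [sum_subset_split _ hsub, hR, hsplit, hsplit (fun m => y m ^ 2)]
      nlinarith only [ih, hL, hE]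
  have hfin := key K le_rfl
  have h1 := mul_nonneg (hcoef K) (div_nonneg (sub_nonneg.2 (hD K le_rfl)) two_pos.le)
  rw [hK, Finset.card_univ, Fintype.card_fin, sum_fin_lt_self, sum_fin_lt_self,
    sum_subset_univ] at hfin
  rw [hK, Finset.card_univ, Fintype.card_fin, sum_fin_lt_self] at h1
  rw [gain, gain]
  linarith

/-! ### Strict inequality for permutations that do not respect the chain -/

/-- A first-order argument: each constraint is slack, decreases to first order along `d`, or is
untouched by `d`, and the objective has positive derivative. The conditions are finitely many, so a
small step works. -/
lemma exists_gain_lt_of_direction {x d : Subs n → ℝ} (hx : ChainFeasible p π x)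
    (hd : ∀ s, d s < 0 → 0 < x s)
    (hcon : ∀ j ≤ n, (∑ s with s.1 ⊆ initial π j, x s ^ 2 < entropyCost p (initial π j)) ∨
      (∑ s with s.1 ⊆ initial π j, x s * d s < 0) ∨ ∀ s : Subs n, s.1 ⊆ initial π j → d s = 0)
    (hgain : 0 < ∑ s, (β * a s - x s) * d s) :
    ∃ x', ChainFeasible p π x' ∧ gain a β x < gain a β x' := by
  have hev : ∀ {f : ℝ → ℝ} {c : ℝ}, Continuous f → f 0 < c → ∀ᶠ ε in 𝓝[>] (0 : ℝ), f ε < c :=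
    fun hf h => (hf.tendsto 0).mono_left nhdsWithin_le_nhds |>.eventually_lt_const h
  have h1 : ∀ᶠ ε in 𝓝[>] (0 : ℝ), ∀ s, 0 ≤ x s + ε * d s := by
    refine eventually_all.2 fun s => ?_
    rcases lt_or_ge (d s) 0 with h | h
    · filter_upwards [hev (f := fun ε => -(x s + ε * d s)) (c := 0) (by fun_prop)
        (by simpa using hd s h)] with ε hε
      linarith
    · filter_upwards [self_mem_nhdsWithin] with ε hε
      exact add_nonneg (hx.1 s) (mul_nonneg (le_of_lt hε) h)
  have hexp : ∀ (F : Finset (Subs n)) (ε : ℝ), ∑ s ∈ F, (x s + ε * d s) ^ 2 =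
      ∑ s ∈ F, x s ^ 2 + ε * (2 * ∑ s ∈ F, x s * d s + ε * ∑ s ∈ F, d s ^ 2) := by
    intro F ε
    simp only [mul_add, Finset.mul_sum, ← Finset.sum_add_distrib]
    exact Finset.sum_congr rfl fun s _ => by ring
  have h2 : ∀ᶠ ε in 𝓝[>] (0 : ℝ), ∀ j ∈ Finset.range (n + 1),
      ∑ s with s.1 ⊆ initial π j, (x s + ε * d s) ^ 2 ≤ entropyCost p (initial π j) := by
    refine (Finset.eventually_all _).2 fun j hj => ?_
    have hj' : j ≤ n := Nat.lt_succ_iff.1 (Finset.mem_range.1 hj)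
    rcases hcon j hj' with h | h | h
    · filter_upwards [hev (f := fun ε => ∑ s with s.1 ⊆ initial π j, (x s + ε * d s) ^ 2)
        (by fun_prop) (by simpa using h)] with ε hε
      exact hε.le
    · filter_upwards [self_mem_nhdsWithin, hev (c := 0)
        (f := fun ε => 2 * ∑ s with s.1 ⊆ initial π j, x s * d s +
          ε * ∑ s with s.1 ⊆ initial π j, d s ^ 2)
        (by fun_prop) (by simp only [zero_mul, add_zero]; linarith)] with ε hε hε2
      rw [hexp]
      have := mul_neg_of_pos_of_neg hε hε2
      linarith [hx.2 j hj']
    · refine Eventually.of_forall fun ε => le_of_eq_of_le ?_ (hx.2 j hj')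
      refine Finset.sum_congr rfl fun s hs => ?_
      rw [h s (Finset.mem_filter.1 hs).2, mul_zero, add_zero]
  have h3 : ∀ᶠ ε in 𝓝[>] (0 : ℝ), gain a β x < gain a β fun s => x s + ε * d s := by
    filter_upwards [self_mem_nhdsWithin, hev (c := 0)
      (f := fun ε => -(∑ s, (β * a s - x s) * d s - ε * ∑ s, d s ^ 2 / 2))
      (by fun_prop) (by simpa using hgain)] with ε hε hε2
    have h4 : gain a β (fun s => x s + ε * d s) = gain a β x +
        ε * (∑ s, (β * a s - x s) * d s - ε * ∑ s, d s ^ 2 / 2) := by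
      simp only [gain, mul_sub, Finset.mul_sum, ← Finset.sum_add_distrib, ← Finset.sum_sub_distrib]
      exact Finset.sum_congr rfl fun s _ => by ring
    rw [h4]
    have := mul_pos hε (neg_lt_zero.1 hε2)
    linarith
  obtain ⟨ε, ⟨h1, h2⟩, h3⟩ := ((h1.and h2).and h3).exists
  exact ⟨_, ⟨h1, fun j hj => h2 j (Finset.mem_range.2 (by omega))⟩, h3⟩

lemma sum_mul_single_add_single (F : Finset (Subs n)) (f : Subs n → ℝ) (s t : Subs n) (u v : ℝ) :
    ∑ r ∈ F, f r * (Pi.single s u + Pi.single t v : Subs n → ℝ) r =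
      (if s ∈ F then f s * u else 0) + if t ∈ F then f t * v else 0 := by
  simp [mul_add, Finset.sum_add_distrib, Pi.single_apply]

/-- Let `G_{i+1}` be the first set of the chain that `π` does not list as an initial set, and `k +
1` the level at which `π` completes it. Some `s ⊆ G_{i+1}` of positive weight is new at that level.
Since `θ_i < β`, raising `x_s` is profitable. If a constraint from level `k + 1` on is tight, the
raise is paid for by lowering `x_t` for some `t` outside `G_{i+1}`: per unit of squared energy the
marginal gain is proportional to `β / θ - 1`, which is smaller for `t`. -/
lemma exists_chainFeasible_gain_lt (h : IsCriticalChain p a β G θ) (hp : ∀ i, 0 < p i)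
    (ha : ∀ s, 0 ≤ a s) {K : ℕ} (hK : G K = Finset.univ) (hθ : ∀ i, i + 1 < K → θ i < β)
    (hπ : ∃ i ≤ K, initial π (G i).card ≠ G i) :
    ∃ x, ChainFeasible p π x ∧ gain a β (optEnergy a G θ) < gain a β x := by
  classical
  have hfeas := feasible_optEnergy h ha hK
  have hopt := (feasible_iff.1 hfeas).2
  obtain ⟨i, hi1, hi2, hi3⟩ : ∃ i, i + 1 < K ∧ initial π (G i).card = G i ∧
      initial π (G (i + 1)).card ≠ G (i + 1) := by
    have hspec := Nat.find_spec hπ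
    obtain ⟨i, hi⟩ : ∃ i, Nat.find hπ = i + 1 := by
      refine Nat.exists_eq_succ_of_ne_zero fun h0 => ?_
      rw [h0, h.zero] at hspec
      exact hspec.2 (initial_zero π)
    rw [hi] at hspec
    refine ⟨i, lt_of_le_of_ne hspec.1 fun h0 => ?_, ?_, hspec.2⟩
    · apply hspec.2
      rw [h0, hK, Finset.card_univ, Fintype.card_fin, initial_self]
    · by_contra h0
      exact Nat.find_min hπ (by omega) ⟨by omega, h0⟩
  have hb := h.pos i
  have hbβ := hθ i hi1
  have hGsub : G i ⊆ G (i + 1) := h.mono (Nat.le_succ i)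
  -- the first level `k + 1` at which `G_{i+1}` is covered
  obtain ⟨k, hk1, hk2⟩ : ∃ k, G (i + 1) ⊆ initial π (k + 1) ∧ ¬ G (i + 1) ⊆ initial π k := by
    have hex : ∃ j, G (i + 1) ⊆ initial π j := ⟨n, by rw [initial_self]; exact Finset.subset_univ _⟩
    obtain ⟨k, hk⟩ : ∃ k, Nat.find hex = k + 1 := by
      refine Nat.exists_eq_succ_of_ne_zero fun h0 => hi3 ?_
      have := Nat.find_spec hex
      rw [h0, initial_zero, Finset.subset_empty] at this
      rw [this]
      exact initial_zero π
    exact ⟨k, hk ▸ Nat.find_spec hex, Nat.find_min hex (by omega)⟩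
  have hGk : G i ⊆ initial π k := by
    rw [← hi2]
    refine initial_mono π ?_
    by_contra! hlt
    have h1 : G (i + 1) ⊆ G i := by
      rw [← hi2]
      exact hk1.trans (initial_mono π hlt)
    rw [Finset.Subset.antisymm h1 hGsub] at hi3
    exact hi3 hi2
  -- a set that first appears at the level `k + 1`
  obtain ⟨s, hs1, hs2, hs3⟩ : ∃ s : Subs n, s.1 ⊆ G (i + 1) ∧ ¬ s.1 ⊆ initial π k ∧ 0 < a s := by
    by_contra! hno
    have hA : G i ⊆ initial π k ∩ G (i + 1) := Finset.subset_inter hGk hGsub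
    have h1 := h.sq_mul_le i _ hA
    have h2 := h.sq_mul_eq i hbβ
    have hlt : entropyCost p (initial π k ∩ G (i + 1)) < entropyCost p (G (i + 1)) := by
      have := entropyCost_pos hp (A := G (i + 1) \ (initial π k ∩ G (i + 1)))
        (Finset.sdiff_nonempty.2 fun h' => hk2 (h'.trans Finset.inter_subset_left))
      rw [entropyCost_sdiff p Finset.inter_subset_right] at this
      linarith
    have hw : wSq a (G (i + 1)) ≤ wSq a (initial π k ∩ G (i + 1)) := by
      rw [wSq, sum_subset_split _ (Finset.inter_subset_right : initial π k ∩ G (i + 1) ⊆ _), wSq,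
        add_le_iff_nonpos_right]
      refine (Finset.sum_eq_zero fun s hs => ?_).le
      obtain ⟨hs1, hs2⟩ := (Finset.mem_filter.1 hs).2
      rw [le_antisymm (hno s hs1 fun h' => hs2 (Finset.subset_inter h' hs1)) (ha s)]
      simp
    rw [entropyCost_sdiff p hA] at h1
    rw [entropyCost_sdiff p hGsub] at h2
    have := mul_le_mul_of_nonneg_left hw (sq_nonneg (θ i))
    linarith
  have hxs : optEnergy a G θ s = θ i * a s := by
    rw [optEnergy, chainLevel_eq h.mono hs1 fun h' => hs2 (h'.trans hGk)]
  have hxs0 : 0 < optEnergy a G θ s := by rw [hxs]; positivity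
  have hsmem : ∀ {j : ℕ}, k + 1 ≤ j → s.1 ⊆ initial π j := fun hj =>
    hs1.trans (hk1.trans (initial_mono π hj))
  by_cases htight : ∃ j, k + 1 ≤ j ∧ j ≤ n ∧
      entropyCost p (initial π j) ≤ ∑ s with s.1 ⊆ initial π j, optEnergy a G θ s ^ 2
  · obtain ⟨hj1, hj2, hj3⟩ := Nat.find_spec htight
    have hmin : ∀ j, k + 1 ≤ j → j ≤ n → j < Nat.find htight →
        ∑ s with s.1 ⊆ initial π j, optEnergy a G θ s ^ 2 < entropyCost p (initial π j) :=
      fun j h1 h2 h3 => not_le.1 fun h4 => Nat.find_min htight h3 ⟨h1, h2, h4⟩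
    set j₀ := Nat.find htight
    have hsub : G (i + 1) ⊆ initial π j₀ := hk1.trans (initial_mono π hj1)
    -- Otherwise all squared energy within level `j₀` comes from `G (i + 1)` and is bounded by its
    -- entropy. That is strictly below the entropy of `initial π j₀`, because `π` does not list `G
    -- (i + 1)` as an initial set; so level `j₀` would not be tight.
    obtain ⟨t, ht1, ht2, ht3⟩ : ∃ t : Subs n, t.1 ⊆ initial π j₀ ∧ ¬ t.1 ⊆ G (i + 1) ∧
        0 < a t := by
      by_contra! hno
      have hne : ¬ initial π j₀ ⊆ G (i + 1) := by
        intro h'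
        have heq := Finset.Subset.antisymm hsub h'
        apply hi3
        rw [heq, card_initial π hj2]
      have hlt := entropyCost_pos hp (Finset.sdiff_nonempty.2 hne)
      rw [entropyCost_sdiff p hsub] at hlt
      rw [sum_subset_split _ hsub] at hj3
      have h0 : ∑ s with s.1 ⊆ initial π j₀ ∧ ¬ s.1 ⊆ G (i + 1), optEnergy a G θ s ^ 2 = 0 := by
        refine Finset.sum_eq_zero fun t ht => ?_
        obtain ⟨ht1, ht2⟩ := (Finset.mem_filter.1 ht).2
        rw [optEnergy, le_antisymm (hno t ht1 ht2) (ha t)]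
        simp
      have := hopt (G (i + 1))
      linarith
    have hts : s ≠ t := fun h' => ht2 (h' ▸ hs1)
    set b := θ (chainLevel G t) with hb'
    have hbb : θ i < b := (h.lt_succ i hbβ).trans_le (h.monotone (lt_chainLevel h.mono hK ht2))
    have hb0 : 0 < b := hb.trans hbb
    have hxt : optEnergy a G θ t = b * a t := rfl
    have hxt0 : 0 < optEnergy a G θ t := by rw [hxt]; positivity
    -- The excess `δ` makes constraints containing both `s` and `t` strictly decrease, yet is small
    -- enough to keep the net gain positive. Below, dividing by the energies makes the changes in `∑
    -- x d` equal to `1` and `-(1 + δ)`.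
    obtain ⟨δ, hδ0, hδ⟩ : ∃ δ > 0, (1 + δ) * (β / b - 1) < β / θ i - 1 := by
      have h1 : β / b < β / θ i := div_lt_div_of_pos_left (hb.trans hbβ) hb hbb
      have h2 : 1 ≤ β / b := (one_le_div hb0).2 (h.le _)
      have h3 : 0 < β / b := by linarith
      refine ⟨(β / θ i - β / b) / (2 * (β / b)), div_pos (by linarith) (by positivity), ?_⟩
      have h4 : (β / θ i - β / b) / (2 * (β / b)) * (β / b) = (β / θ i - β / b) / 2 := by
        field_simp
      have h5 : 0 < (β / θ i - β / b) / (2 * (β / b)) := div_pos (by linarith) (by positivity)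
      nlinarith only [h1, h4, h5]
    refine exists_gain_lt_of_direction (hfeas.chainFeasible π)
      (d := Pi.single s (optEnergy a G θ s)⁻¹ + Pi.single t (-(1 + δ) * (optEnergy a G θ t)⁻¹))
      (fun r hr => ?_) (fun j hj => ?_) ?_
    · by_cases hrt : r = t
      · rw [hrt]
        exact hxt0
      · by_cases hrs : r = s
        · rw [hrs]
          exact hxs0
        · simp [hrt, hrs] at hr
    · rw [sum_mul_single_add_single]
      simp only [Finset.mem_filter, Finset.mem_univ, true_and]
      have e1 : optEnergy a G θ s * (optEnergy a G θ s)⁻¹ = 1 := mul_inv_cancel₀ hxs0.ne'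
      have e2 : optEnergy a G θ t * (-(1 + δ) * (optEnergy a G θ t)⁻¹) = -(1 + δ) := by
        field_simp
      rw [e1, e2]
      rcases Nat.lt_or_ge k j with hkj | hkj
      · rcases lt_or_ge j j₀ with hjj | hjj
        · exact Or.inl (hmin j hkj hj hjj)
        · rw [if_pos (hsmem hkj), if_pos (ht1.trans (initial_mono π hjj))]
          exact Or.inr (Or.inl (by linarith))
      · have hns : ¬ s.1 ⊆ initial π j := fun h' => hs2 (h'.trans (initial_mono π hkj))
        rw [if_neg hns]
        by_cases htj : t.1 ⊆ initial π j
        · rw [if_pos htj]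
          exact Or.inr (Or.inl (by linarith))
        · refine Or.inr (Or.inr fun r hr => ?_)
          have hrs : r ≠ s := fun h' => hns (h' ▸ hr)
          have hrt : r ≠ t := fun h' => htj (h' ▸ hr)
          simp [hrs, hrt]
    · rw [sum_mul_single_add_single]
      simp only [Finset.mem_univ, if_true]
      have e1 : (β * a s - optEnergy a G θ s) * (optEnergy a G θ s)⁻¹ = β / θ i - 1 := by
        rw [hxs]
        field_simp
      have e2 : (β * a t - optEnergy a G θ t) * (-(1 + δ) * (optEnergy a G θ t)⁻¹) =
          -((1 + δ) * (β / b - 1)) := by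
        rw [hxt]
        field_simp
      rw [e1, e2]
      linarith
  · push Not at htight
    refine exists_gain_lt_of_direction (hfeas.chainFeasible π)
      -- Only `x_s` is raised; the zero summand gives `d` the shape required by
      -- `sum_mul_single_add_single`.
      (d := Pi.single s 1 + Pi.single s 0) (fun r hr => ?_) (fun j hj => ?_) ?_
    · by_cases hrs : r = s
      · rw [hrs]
        exact hxs0
      · simp [hrs] at hr
    · rcases Nat.lt_or_ge k j with hkj | hkj
      · exact Or.inl (htight j hkj hj)
      · refine Or.inr (Or.inr fun r hr => ?_)
        have hrs : r ≠ s := fun h' => hs2 (h' ▸ hr.trans (initial_mono π hkj))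
        simp [hrs]
    · rw [sum_mul_single_add_single, hxs]
      simp only [Finset.mem_univ, if_true, mul_one, mul_zero, add_zero]
      rw [← sub_mul]
      exact mul_pos (sub_pos.2 hbβ) hs3

end Sums

/-! ### Application to the Bolthausen-Kistler and to the tree model -/

section Models

variable {n : ℕ} {p : Fin n → ℝ} {a : Subs n → ℝ} {β : ℝ} {Ω : Type*} [MeasurableSpace Ω]
  {P : Measure Ω}

lemma isSiteMap_proj {ℓ : Fin n → ℕ} :
    IsSiteMap (ℓ := ℓ) (Subtype.val : Subs n → Finset (Fin n)) proj := by
  intro σ τ s t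
  constructor
  · intro h
    obtain rfl : s = t := congrArg Sigma.fst h
    have h2 := eq_of_heq (Sigma.mk.inj h).2
    exact ⟨rfl, fun m hm => congrFun h2 ⟨m, hm⟩⟩
  · rintro ⟨rfl, h⟩
    simp only [proj]
    congr 1
    funext i
    exact h i.1 i.2

lemma isSiteMap_ancestor {ℓ : Fin n → ℕ} :
    IsSiteMap (ℓ := ℓ) (fun i : Fin n => Finset.Iic i) ancestor := by
  intro σ τ i j
  constructor
  · intro h
    obtain rfl : i = j := congrArg Sigma.fst h
    have h2 := eq_of_heq (Sigma.mk.inj h).2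
    exact ⟨rfl, fun m hm => congrFun h2 ⟨m, Finset.mem_Iic.1 hm⟩⟩
  · rintro ⟨rfl, h⟩
    simp only [ancestor]
    congr 1
    funext m
    exact h m.1 (Finset.mem_Iic.2 m.2)

lemma IsGaussianField.isStdGaussian {ι : ℕ → Type*} {v : ℕ → ℝ≥0} {ξ : (N : ℕ) → ι N → Ω → ℝ}
    (h : IsGaussianField P n v ξ) {N : ℕ} (hN : n ≤ N) {c : ℝ} (hc : c ^ 2 * v N = 1) :
    IsStdGaussian P fun e ω => c * ξ N e ω where
  measurable e := (h.measurable N hN e).const_mul c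
  law e := by
    have h1 : P.map (fun ω => c * ξ N e ω) = (P.map (ξ N e)).map (c * ·) :=
      (Measure.map_map (measurable_const_mul c) (h.measurable N hN e)).symm
    rw [h1, h.law N hN e, gaussianReal_map_const_mul, mul_zero]
    congr 1
    exact NNReal.eq hc
  indep := (h.indep N hN).comp (fun _ x => c * x) fun _ => measurable_const_mul c

lemma ae_tendsto_bk_freeEnergy (hn : 1 ≤ n) (ha : ∀ s, 0 ≤ a s) (hp : ∀ i, 0 < p i)
    {k : ℕ → Fin n → ℕ} (hk : ∀ N, n ≤ N → (∀ i, 1 ≤ k N i) ∧ ∑ i, k N i = N)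
    (hlim : ∀ i, Tendsto (fun N => (k N i : ℝ) / N) atTop (𝓝 (p i))) [IsProbabilityMeasure P]
    {ξ : (N : ℕ) → Site (k N) → Ω → ℝ} (hξ : IsBKField P k ξ) :
    ∀ᵐ ω ∂P, ∀ β : ℝ, 0 < β →
      Tendsto (fun N => freeEnergy N (bkHamiltonian a N fun e => ξ N e ω) β) atTop
        (𝓝 (Real.log 2 + maxGain Subtype.val p a β)) := by
  -- The factor `-√N` normalises the variance `1 / N` and absorbs the sign in `exp (-β H)`.
  have h := ae_tendsto_logPartition (c := a) (P := P) (site := fun N => proj)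
    (X := fun N e ω => -√N * ξ N e ω) (fun s : Subs n => s.2) (fun N => isSiteMap_proj)
    (fun N hN => IsGaussianField.isStdGaussian hξ hN (by
      have hN' : (N : ℝ) ≠ 0 := by
        have : N ≠ 0 := by omega
        exact_mod_cast this
      rw [neg_sq, Real.sq_sqrt (Nat.cast_nonneg N)]
      simp [hN']))
    (fun N hN => (hk N hN).2) hp ha hlim
  filter_upwards [h] with ω hω β hβ
  refine (hω β hβ).congr fun N => ?_
  rw [freeEnergy, logPartition, partitionFunction]
  congr 2
  refine Finset.sum_congr rfl fun σ _ => ?_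
  rw [bkHamiltonian, Finset.mul_sum, Finset.mul_sum, Finset.mul_sum]
  congr 1
  refine Finset.sum_congr rfl fun s _ => ?_
  linear_combination (-β * a s * ξ N (proj σ s) ω) * Real.mul_self_sqrt (Nat.cast_nonneg N)

lemma ae_tendsto_tree_freeEnergy (hn : 1 ≤ n) (hp : ∀ i, 0 < p i) {k : ℕ → Fin n → ℕ}
    (hk : ∀ N, n ≤ N → (∀ i, 1 ≤ k N i) ∧ ∑ i, k N i = N)
    (hlim : ∀ i, Tendsto (fun N => (k N i : ℝ) / N) atTop (𝓝 (p i))) [IsProbabilityMeasure P]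
    (π : Equiv.Perm (Fin n)) {b : Fin n → ℝ} (hb : ∀ i, 0 ≤ b i)
    {η : (N : ℕ) → Node (fun i => k N (π i)) → Ω → ℝ}
    (hη : IsTreeField P (fun N i => k N (π i)) η) :
    ∀ᵐ ω ∂P, ∀ β : ℝ, 0 < β →
      Tendsto (fun N => freeEnergy N (treeHamiltonian b fun e => η N e ω) β) atTop
        (𝓝 (Real.log 2 + maxGain (fun i : Fin n => Finset.Iic i) (fun i => p (π i)) b β)) := by
  have hN0 : ∀ N : ℕ, n ≤ N → (0 : ℝ) < N := fun N hN => by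
    have : 0 < N := by omega
    exact_mod_cast this
  have h := ae_tendsto_logPartition (c := b) (P := P) (site := fun N => ancestor)
    (X := fun N e ω => -(√N)⁻¹ * η N e ω) (fun i : Fin n => ⟨i, Finset.mem_Iic.2 le_rfl⟩)
    (fun N => isSiteMap_ancestor)
    (fun N hN => IsGaussianField.isStdGaussian hη hN (by
      rw [neg_sq, inv_pow, Real.sq_sqrt (Nat.cast_nonneg N)]
      simp [(hN0 N hN).ne']))
    (fun N hN => (Equiv.sum_comp π (k N)).trans (hk N hN).2) (fun i => hp (π i)) hb
    (fun i => hlim (π i))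
  filter_upwards [h] with ω hω β hβ
  refine (hω β hβ).congr' ?_
  filter_upwards [eventually_ge_atTop n] with N hN
  have hs : √(N : ℝ) * (√N)⁻¹ = 1 := mul_inv_cancel₀ (Real.sqrt_pos.2 (hN0 N hN)).ne'
  rw [freeEnergy, logPartition, partitionFunction]
  congr 2
  refine Finset.sum_congr rfl fun σ _ => ?_
  rw [treeHamiltonian, Finset.mul_sum, Finset.mul_sum]
  congr 1
  refine Finset.sum_congr rfl fun i _ => ?_
  linear_combination (-β * b i * η N (ancestor σ i) ω) * hs

lemma maxGain_le_tree (hp : ∀ i, 0 < p i) (hβ : 0 < β) (π : Equiv.Perm (Fin n)) :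
    maxGain Subtype.val p a β ≤
      maxGain (fun i : Fin n => Finset.Iic i) (fun i => p (π i)) (levelWeight a π) β := by
  refine maxGain_le hp fun x hx => ?_
  obtain ⟨y, hy, hxy⟩ := exists_tree_feasible hp hβ (hx.chainFeasible π)
  exact hxy.trans (gain_le_maxGain hy)

lemma tree_gain_le_of_mem_finalClass (hp : ∀ i, 0 < p i) (hβ : 0 < β)
    {π : Equiv.Perm (Fin n)} (hπ : π ∈ finalClass p a) {y : Fin n → ℝ}
    (hy : Feasible (fun i : Fin n => Finset.Iic i) (fun i => p (π i)) y) :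
    gain (levelWeight a π) β y ≤
      gain a β (optEnergy a (fun i => (stage p a i).1) (truncCritical p a β)) :=
  tree_gain_le (isCriticalChain_stage hp a hβ) hp (stage_numStages p a) (mem_stage_iff.1 hπ) hy

lemma feasible_optEnergy_stage (hp : ∀ i, 0 < p i) (ha : ∀ s, 0 ≤ a s) (hβ : 0 < β) :
    Feasible Subtype.val p (optEnergy a (fun i => (stage p a i).1) (truncCritical p a β)) :=
  feasible_optEnergy (isCriticalChain_stage hp a hβ) ha (stage_numStages p a)

lemma maxGain_tree_eq (hp : ∀ i, 0 < p i) (ha : ∀ s, 0 ≤ a s) (hβ : 0 < β)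
    {π : Equiv.Perm (Fin n)} (hπ : π ∈ finalClass p a) :
    maxGain (fun i : Fin n => Finset.Iic i) (fun i => p (π i)) (levelWeight a π) β =
      maxGain Subtype.val p a β :=
  le_antisymm (maxGain_le (fun i => hp (π i)) fun _ hy =>
    (tree_gain_le_of_mem_finalClass hp hβ hπ hy).trans
      (gain_le_maxGain (feasible_optEnergy_stage hp ha hβ))) (maxGain_le_tree hp hβ π)

/-- Optimality is obtained through the tree of any member of the nonempty class `𝒫_K`, which bounds
the supremum from above. -/
lemma maxGain_eq_gain_optEnergy (hp : ∀ i, 0 < p i) (ha : ∀ s, 0 ≤ a s) (hβ : 0 < β) :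
    maxGain Subtype.val p a β =
      gain a β (optEnergy a (fun i => (stage p a i).1) (truncCritical p a β)) := by
  obtain ⟨π, hπ⟩ := (stage_spec p a (numStages p a)).1
  refine le_antisymm ?_ (gain_le_maxGain (feasible_optEnergy_stage hp ha hβ))
  exact (maxGain_le_tree hp hβ π).trans (maxGain_le (fun i => hp (π i)) fun _ hy =>
    tree_gain_le_of_mem_finalClass hp hβ hπ hy)

lemma maxGain_lt_tree (hp : ∀ i, 0 < p i) (ha : ∀ s, 0 ≤ a s) (hβ : 0 < β)
    (hc : critical p a (numStages p a - 1) < ENNReal.ofReal β)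
    {π : Equiv.Perm (Fin n)} (hπ : π ∉ finalClass p a) :
    maxGain Subtype.val p a β <
      maxGain (fun i : Fin n => Finset.Iic i) (fun i => p (π i)) (levelWeight a π) β := by
  have hπ' : ∃ i ≤ numStages p a, initial π (stage p a i).1.card ≠ (stage p a i).1 := by
    by_contra! h
    exact hπ (mem_stage_iff.2 h)
  obtain ⟨x, hx, hlt⟩ := exists_chainFeasible_gain_lt (isCriticalChain_stage hp a hβ) hp ha
    (stage_numStages p a) (fun i hi => truncCritical_lt hp hβ hc (by omega)) hπ'
  obtain ⟨y, hy, hxy⟩ := exists_tree_feasible (a := a) hp hβ hx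
  rw [maxGain_eq_gain_optEnergy hp ha hβ]
  exact hlt.trans_le (hxy.trans (gain_le_maxGain hy))

end Models

end BKGREM

theorem theorem3p5p2 (n : ℕ) (hn : 1 ≤ n)
    -- the weights and the limiting proportions
    (a : BKGREM.Subs n → ℝ) (ha : ∀ s, 0 ≤ a s) (p : Fin n → ℝ) (hp : ∀ i, 0 < p i)
    -- the partitions `N = k(1,N) + ⋯ + k(n,N)`
    (k : ℕ → Fin n → ℕ) (hk : ∀ N, n ≤ N → (∀ i, 1 ≤ k N i) ∧ ∑ i, k N i = N)
    (hlim : ∀ i, Tendsto (fun N => (k N i : ℝ) / N) atTop (𝓝 (p i)))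
    -- a Gaussian BK-GREM
    {Ω : Type*} [MeasurableSpace Ω] (P : Measure Ω) [IsProbabilityMeasure P]
    (ξ : (N : ℕ) → BKGREM.Site (k N) → Ω → ℝ) (hξ : BKGREM.IsBKField P k ξ)
    -- for every permutation `π`, a Gaussian tree GREM
    {Ω' : Equiv.Perm (Fin n) → Type*} [∀ π, MeasurableSpace (Ω' π)]
    (P' : (π : Equiv.Perm (Fin n)) → Measure (Ω' π)) [∀ π, IsProbabilityMeasure (P' π)]
    (η : (π : Equiv.Perm (Fin n)) → (N : ℕ) → BKGREM.Node (fun i => k N (π i)) → Ω' π → ℝ)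
    (hη : ∀ π, BKGREM.IsTreeField (P' π) (fun N i => k N (π i)) (η π)) :
    -- the limiting free energies
    ∃ (E : ℝ → ℝ) (T : Equiv.Perm (Fin n) → ℝ → ℝ),
      (∀ᵐ ω ∂P, ∀ β : ℝ, 0 < β → Tendsto (fun N => BKGREM.freeEnergy N
        (BKGREM.bkHamiltonian a N fun e => ξ N e ω) β) atTop (𝓝 (E β))) ∧
      (∀ π, ∀ᵐ ω ∂(P' π), ∀ β : ℝ, 0 < β → Tendsto (fun N => BKGREM.freeEnergy N
        (BKGREM.treeHamiltonian (BKGREM.levelWeight a π) fun e => η π N e ω) β)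
          atTop (𝓝 (T π β))) ∧
      -- the minimum formula
      (∀ β : ℝ, 0 < β → IsLeast (Set.range fun π => T π β) (E β)) ∧
      -- the permutations that attain the minimum
      (∀ π, π ∈ BKGREM.finalClass p a ↔ ∀ β : ℝ, 0 < β → T π β = E β) ∧
      (∀ β : ℝ, 0 < β → BKGREM.critical p a (BKGREM.numStages p a - 1) < ENNReal.ofReal β →
        ∀ π, T π β = E β ↔ π ∈ BKGREM.finalClass p a) := by
  refine ⟨fun β => Real.log 2 + BKGREM.maxGain Subtype.val p a β, fun π β => Real.log 2 +
    BKGREM.maxGain (fun i : Fin n => Finset.Iic i) (fun i => p (π i)) (BKGREM.levelWeight a π) β,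
    BKGREM.ae_tendsto_bk_freeEnergy hn ha hp hk hlim hξ,
    fun π => BKGREM.ae_tendsto_tree_freeEnergy hn hp hk hlim π (BKGREM.levelWeight_nonneg a π)
      (hη π), fun β hβ => ?_, ?_⟩
  · obtain ⟨π, hπ⟩ := (BKGREM.stage_spec p a (BKGREM.numStages p a)).1
    refine ⟨⟨π, ?_⟩, ?_⟩
    · exact congrArg _ (BKGREM.maxGain_tree_eq hp ha hβ hπ)
    · rintro _ ⟨τ, rfl⟩
      exact add_le_add_right (BKGREM.maxGain_le_tree hp hβ τ) _
  have key : ∀ β : ℝ, 0 < β →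
      BKGREM.critical p a (BKGREM.numStages p a - 1) < ENNReal.ofReal β → ∀ π,
      Real.log 2 + BKGREM.maxGain (fun i : Fin n => Finset.Iic i) (fun i => p (π i))
        (BKGREM.levelWeight a π) β = Real.log 2 + BKGREM.maxGain Subtype.val p a β ↔
      π ∈ BKGREM.finalClass p a := by
    intro β hβ hc π
    rw [add_right_inj]
    refine ⟨fun h => ?_, BKGREM.maxGain_tree_eq hp ha hβ⟩
    by_contra hπ
    exact (BKGREM.maxGain_lt_tree hp ha hβ hc hπ).ne' h
  refine ⟨fun π => ⟨fun hπ β hβ => congrArg _ (BKGREM.maxGain_tree_eq hp ha hβ hπ), fun h => ?_⟩,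
    key⟩
  -- As `n ≥ 1`, the empty set `G_0` is not everything; so `K - 1` is a genuine predecessor and
  -- `β_{K-1}` is finite. Equality at a single real `r > β_{K-1}` then decides membership in the
  -- class.
  have hK : BKGREM.numStages p a ≠ 0 := by
    intro h0
    have h1 := BKGREM.stage_numStages p a
    rw [h0] at h1
    have h2 := congrArg Finset.card h1
    simp [BKGREM.stage] at h2
    omega
  obtain ⟨r, -, hr⟩ := ENNReal.lt_iff_exists_real_btwn.1 (BKGREM.critical_ne_top_of_lt (p := p)
    (a := a) (Nat.sub_one_lt hK)).lt_top
  have hr0 : 0 < r := ENNReal.ofReal_pos.1 (zero_le.trans_lt hr.1)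
  exact (key r hr0 hr.1 π).1 (h r hr0)
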